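/- A double poset $D$ on a finite set $N$ with $n$ elements consists of two partial orders $\le_1,\le_2$ on $N$; write $\prec_1$ for the covering relation of $\le_1$. A pair $(a,b)$ is an inversion if $a<_1b$ and $b<_2a$, and a descent if moreover $a\prec_1 b$. $D$ is inversion-reducible if for every inversion $(a,b)$ either $(a,b)$ is a descent or there is $c$ with $a<_1c<_1b$ such that $(a,c)$ or $(c,b)$ is an inversion. A $D$-partition is a function $f:N\to\mathbb N$ with $f(i)\le f(j)$ whenever $i\le_1 j$, and $f(i)<f(j)$ whenever $i<_1j$ and $j<_2i$. A mixed graph $G=(V,U,E)$ on a finite set $V$ has a set $U$ of undirected edges and a set $E$ of directed edges. A weak coloring is a function $f:V\to\mathbb N$ with $f(u)\ne f(v)$ for $uv\in U$ and $f(u)\le f(v)$ for $(u,v)\in E$. A mixed cycle is a cyclic sequence of at least three distinct vertices, together with, for each pair of consecutive vertices, an edge of $G$ joining them, which is either undirected or directed from the first to the second, at least one of these edges being directed. Let $m(G)$ be the minimum number of undirected edges on a mixed cycle of $G$, and $m(G)=|V|$ if $G$ has no mixed cycle. The mixed graph $G(D)$ has vertex set $N$, directed edges $(u,v)$ for all $u\prec_1v$,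 and undirected edges $uv$ for all $u\prec_1v$ with $v\le_2u$. Put $m(D)=m(G(D))$. If a finite group $\mathfrak G$ acts on $N$, it acts on functions $f:N\to\mathbb N$ by $(\mathfrak g f)(v)=f(\mathfrak g^{-1}v)$. For $\mathfrak g\in\mathfrak G$ put $\mathbf x^f=\prod_{v}x_{f(v)}$, $\Omega(D,\mathfrak G,\mathbf x;\mathfrak g)=\sum_f\mathbf x^f$ over all $D$-partitions $f$ with $\mathfrak gf=f$, and $\chi(G,\mathfrak G,\mathbf x;\mathfrak g)=\sum_f\mathbf x^f$ over all weak colorings $f$ of $G$ with $\mathfrak gf=f$. For $S=\{s_1<\dots<s_k\}\subseteq[n-1]$ let $M_{S,n}=\sum_{i_1<\dots<i_{k+1}}\prod_{j=1}^{k+1}x_{i_j}^{s_j-s_{j-1}}$ with $s_0=0$, $s_{k+1}=n$ (and $M_{\emptyset,0}=1$), and let $F_{S,n}=\sum_{S\subseteq T\subseteq[n-1]}M_{T,n}$. Theorem. Let $D$ be an inversion-reducible double poset on $n$ elements, and let a finite group $\mathfrak G$ act on $D$, that is, on $N$ by automorphisms of both orders. Then $\mathfrak G$ acts on $G(D)$,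 that is, every $\mathfrak g\in\mathfrak G$ preserves the undirected and the directed edges of $G(D)$, and $$\Omega(D,\mathfrak G,\mathbf x)=\chi(G(D),\mathfrak G,\mathbf x).$$ Moreover, there are unique functions $[F_{S,n}]\Omega(D,\mathfrak G,\mathbf x):\mathfrak G\to\mathbb C$, for $S\subseteq[n-1]$, with $$\Omega(D,\mathfrak G,\mathbf x;\mathfrak g)=\sum_{S\subseteq[n-1]}[F_{S,n}]\Omega(D,\mathfrak G,\mathbf x)(\mathfrak g)\,F_{S,n}\quad\text{for all }\mathfrak g\in\mathfrak G,$$ and for every $S\subseteq[n-1]$ with $|S|\le m(D)$ the function $[F_{S,n}]\Omega(D,\mathfrak G,\mathbf x)$ is an effective character of $\mathfrak G$, that is, the character of a finite-dimensional complex representation (possibly zero). -/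

import Mathlib

/-! ### Quasisymmetric functions -/

/-- The generating function `∑_{f ∈ A} 𝐱^f`, `𝐱^f = ∏_v x_{f v}`, of a set `A` of functions
`N → ℕ` on a finite set `N`, as a formal power series in `x_0, x_1, x_2, …`: the coefficient of a
monomial `d` is the number of `f ∈ A` with `𝐱^f = d`. -/
noncomputable def genFun {N : Type*} [Fintype N] (A : Set (N → ℕ)) : MvPowerSeries ℕ ℂ :=
  fun d => (Nat.card {f : N → ℕ // f ∈ A ∧ ∑ v, Finsupp.single (f v) 1 = d} : ℂ)

/-- The composition `(s₁, s₂ - s₁, …, n - s_k)` of `n` given by a subset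
`{s₁ < ⋯ < s_k}` of `[n-1]`; the element `i : Fin (n - 1)` stands for `i + 1 ∈ [n-1]`. -/
def subsetComposition (n : ℕ) (S : Finset (Fin (n - 1))) : Composition n :=
  ((compositionAsSetEquiv n).symm S).toComposition

/-- The monomial quasisymmetric function
`M_{S,n} = ∑_{i₁ < ⋯ < i_{k+1}} ∏_j x_{i_j}^{s_j - s_{j-1}}`: the coefficient of a monomial `d` is
the number of increasing sequences `i` with `∏_j x_{i_j}^{s_j - s_{j-1}} = d`. -/
noncomputable def monomialQSym (n : ℕ) (S : Finset (Fin (n - 1))) : MvPowerSeries ℕ ℂ :=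
  fun d => (Nat.card {i : Fin (subsetComposition n S).length → ℕ //
    StrictMono i ∧
      ∑ j, Finsupp.single (i j) ((subsetComposition n S).blocksFun j) = d} : ℂ)

/-- The fundamental quasisymmetric function `F_{S,n} = ∑_{T ⊇ S} M_{T,n}`. -/
noncomputable def fundamentalQSym (n : ℕ) (S : Finset (Fin (n - 1))) : MvPowerSeries ℕ ℂ :=
  ∑ T : Finset (Fin (n - 1)) with S ⊆ T, monomialQSym n T

/-- `c` is the family of coefficients of `Φ` in the fundamental basis in degree `n`:
`Φ(g) = ∑_{S ⊆ [n-1]} c_S(g) F_{S,n}` for all `g`. -/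
def IsFundamentalExpansion {G : Type*} (n : ℕ) (Φ : G → MvPowerSeries ℕ ℂ)
    (c : Finset (Fin (n - 1)) → G → ℂ) : Prop :=
  ∀ g, Φ g = ∑ S, c S g • fundamentalQSym n S

/-- `χ` is the character of a finite-dimensional complex representation of `G` (possibly the zero
representation). For finite `G` these are the nonnegative integer combinations of irreducible
characters. -/
def IsEffectiveCharacter {G : Type*} [Group G] (χ : G → ℂ) : Prop :=
  ∃ (d : ℕ) (ρ : Representation ℂ G (Fin d → ℂ)), χ = ρ.character

/-- The functions `f : N → ℕ` in `A` with `g • f = f`, where `(g • f) v = f (g⁻¹ • v)`. -/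
def fixedFunctions {G N : Type*} [Group G] [MulAction G N] (A : Set (N → ℕ)) (g : G) :
    Set (N → ℕ) :=
  {f | f ∈ A ∧ (fun v => f (g⁻¹ • v)) = f}

/-! ### Mixed graphs -/

/-- A mixed graph: undirected edges and directed edges on the same vertex set. -/
structure MixedGraph (V : Type*) where
  undirected : SimpleGraph V
  directed : Digraph V

namespace MixedGraph

variable {V : Type*}

/-- A permutation of the vertices is an automorphism if it preserves undirected and directed
edges. -/
def IsAutomorphism (Γ : MixedGraph V) (σ : Equiv.Perm V) : Prop :=
  (∀ u v, Γ.undirected.Adj (σ u) (σ v) ↔ Γ.undirected.Adj u v) ∧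
    ∀ u v, Γ.directed.Adj (σ u) (σ v) ↔ Γ.directed.Adj u v

/-- Weak colorings. -/
def weakColorings (Γ : MixedGraph V) : Set (V → ℕ) :=
  {f | (∀ u v, Γ.undirected.Adj u v → f u ≠ f v) ∧ ∀ u v, Γ.directed.Adj u v → f u ≤ f v}

/-- `χ(Γ, 𝔊, 𝐱; g)`: the generating function of the weak colorings fixed by `g`. -/
noncomputable def chromaticQSym [Fintype V] (Γ : MixedGraph V) (G : Type*) [Group G]
    [MulAction G V] (g : G) : MvPowerSeries ℕ ℂ :=
  genFun (fixedFunctions Γ.weakColorings g)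

/-- `w 0, w 1, …, w (k+2), w 0` is a mixed cycle of length `k + 3`: the vertices are distinct, the
edges with index in `E` are undirected, the others are directed edges followed in their direction,
and at least one of them is directed. -/
def IsMixedCycle (Γ : MixedGraph V) {k : ℕ} (w : Fin (k + 3) → V) (E : Finset (Fin (k + 3))) :
    Prop :=
  Function.Injective w ∧ (∀ i ∈ E, Γ.undirected.Adj (w i) (w (i + 1))) ∧
    (∀ i ∉ E, Γ.directed.Adj (w i) (w (i + 1))) ∧ ∃ i, i ∉ E

/-- The numbers of undirected edges on the mixed cycles of `Γ`. -/
def mixedCycleCounts (Γ : MixedGraph V) : Set ℕ :=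
  {j | ∃ (k : ℕ) (w : Fin (k + 3) → V) (E : Finset (Fin (k + 3))),
    Γ.IsMixedCycle w E ∧ E.card = j}

open Classical in
/-- `m(Γ)`: the minimum number of undirected edges on a mixed cycle, and the number of vertices if
there is no mixed cycle. -/
noncomputable def m [Fintype V] (Γ : MixedGraph V) : ℕ :=
  if Γ.mixedCycleCounts.Nonempty then sInf Γ.mixedCycleCounts else Fintype.card V

end MixedGraph

/-! ### Double posets -/

/-- A double poset on `N`: two partial orders on `N`. -/
structure DoublePoset (N : Type*) where
  ord₁ : PartialOrder N
  ord₂ : PartialOrder N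

namespace DoublePoset

variable {N : Type*}

/-- `a ≤₁ b` -/
def le₁ (D : DoublePoset N) (a b : N) : Prop := D.ord₁.le a b

/-- `a ≤₂ b` -/
def le₂ (D : DoublePoset N) (a b : N) : Prop := D.ord₂.le a b

/-- `a <₁ b` -/
def lt₁ (D : DoublePoset N) (a b : N) : Prop := D.ord₁.lt a b

/-- `a <₂ b` -/
def lt₂ (D : DoublePoset N) (a b : N) : Prop := D.ord₂.lt a b

/-- `a ≺₁ b`: `b` covers `a` in the first order. -/
def covBy₁ (D : DoublePoset N) (a b : N) : Prop :=
  D.lt₁ a b ∧ ∀ c, ¬ (D.lt₁ a c ∧ D.lt₁ c b)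

/-- `(a, b)` is an inversion. -/
def IsInversion (D : DoublePoset N) (a b : N) : Prop := D.lt₁ a b ∧ D.lt₂ b a

/-- `(a, b)` is a descent. -/
def IsDescent (D : DoublePoset N) (a b : N) : Prop := D.IsInversion a b ∧ D.covBy₁ a b

/-- Every inversion is a descent or can be shortened to an inversion. -/
def InversionReducible (D : DoublePoset N) : Prop :=
  ∀ a b, D.IsInversion a b → D.IsDescent a b ∨
    ∃ c, D.lt₁ a c ∧ D.lt₁ c b ∧ (D.IsInversion a c ∨ D.IsInversion c b)

/-- `D`-partitions. -/
def partitions (D : DoublePoset N) : Set (N → ℕ) :=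
  {f | (∀ i j, D.le₁ i j → f i ≤ f j) ∧ ∀ i j, D.lt₁ i j → D.lt₂ j i → f i < f j}

/-- `𝔊` acts on `D`, i.e. by automorphisms of the double poset. -/
def ActsOn (G : Type*) [Group G] [MulAction G N] (D : DoublePoset N) : Prop :=
  ∀ (g : G) (i j : N), (D.le₁ i j → D.le₁ (g • i) (g • j)) ∧ (D.le₂ i j → D.le₂ (g • i) (g • j))

/-- `Ω(D, 𝔊, 𝐱; g)`: the generating function of the `D`-partitions fixed by `g`. -/
noncomputable def partitionQSym [Fintype N] (D : DoublePoset N) (G : Type*) [Group G]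
    [MulAction G N] (g : G) : MvPowerSeries ℕ ℂ :=
  genFun (fixedFunctions D.partitions g)

/-- The mixed graph `G(D)`: its directed edges are the pairs `(u, v)` with `u ≺₁ v`, its undirected
edges the pairs `uv` with `u ≺₁ v` and `v ≤₂ u`. -/
def mixedGraph (D : DoublePoset N) : MixedGraph N where
  undirected := SimpleGraph.fromRel fun u v => D.covBy₁ u v ∧ D.le₂ v u
  directed := { Adj := D.covBy₁ }

end DoublePoset

/-! By inversion-reducibility, strictness on descents propagates to all inversions. So
`D`-partitions are the functions weakly increasing along `≺₁` and strictly increasing along the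
covers (u, v) with v ≤₂ u, and these are also the weak colorings of G(D).

Such a function is determined by its content and by the chain of its proper nonempty initial
segments, a chain of order ideals separating every strict pair. Hence the coefficient of M_T at g
counts the g-fixed chains whose set of cardinalities is T. Möbius inversion turns the coefficient of
F_S into an alternating sum over the fixed chains with cardinalities in S, which up to sign is an
equivariant Euler characteristic of the relative complex `faces`. Group elements preserve
cardinalities, so no orientation signs arise. If the cohomology vanishes on faces with fewer than
|S| members, the sum is the character of the top cochains modulo coboundaries
(`isEffectiveCharacter_of_acyclicAt`).

The vanishing (`acyclicAt_faces`) comes from dropping strict pairs one at a time. The chains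
separating u from v form an upper part of all chains, and the complement consists of the chains for
the relation enlarged by v → u. The long exact sequence bounds the cohomology of the upper part in
degree i by that of the whole in degree i and of the complement in degree i - 1. This leaves
preorders with no strict pairs, in which a set A of pairs has been reversed at the price of one
degree each. For a preorder with c classes, the cohomology vanishes in degree i when i + n < |S| + c
(`acyclicAt_faces_empty`): relations are added until the preorder is total, where the complex is a
simplex.

So each reversal may merge away at most one class. It loses more only if something lies strictly
between u and v. Then a path from u to v, closed up by the undirected edge uv, is a mixed cycle with
at most |A| + 1 undirected edges, which |S| ≤ m(D) excludes (`card_le_numClasses_add_card`). -/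

/-! ### Cochains of colored relative simplicial complexes -/

namespace ColoredComplex

open Classical in
/-- The incidence sign of the vertex `I` in the face `F`, whose vertices are ordered by their
colors. -/
noncomputable def incidence {V : Type*} (κ : V → ℕ) (F : Finset V) (I : V) : ℂ :=
  (-1) ^ (F.filter fun J => κ J < κ I).card

open Classical in
/-- The coboundary operator of a set `X` of faces. -/
noncomputable def coboundary {V : Type*} (κ : V → ℕ) (X : Set (Finset V)) :
    (Finset V → ℂ) →ₗ[ℂ] (Finset V → ℂ) where
  toFun φ F := if F ∈ X then ∑ I ∈ F, incidence κ F I * φ (F.erase I) else 0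
  map_add' φ ψ := by
    funext F
    by_cases h : F ∈ X <;> simp [h, mul_add, Finset.sum_add_distrib]
  map_smul' a φ := by
    funext F
    by_cases h : F ∈ X <;> simp [h, Finset.mul_sum, mul_left_comm]

/-- The cochains supported on the faces in `X` with `i` vertices. -/
def cochains {V : Type*} (X : Set (Finset V)) (i : ℕ) : Submodule ℂ (Finset V → ℂ) where
  carrier := {φ | ∀ F, φ F ≠ 0 → F ∈ X ∧ F.card = i}
  add_mem' {φ ψ} hφ hψ F h := by
    by_cases h0 : φ F = 0
    · exact hψ F (by simpa [h0] using h)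
    · exact hφ F h0
  zero_mem' F h := absurd rfl h
  smul_mem' a φ hφ F h := hφ F (by
    intro h0
    exact h (by simp [h0]))

/-- The cohomology of `X` vanishes at the faces with `i` vertices. -/
def AcyclicAt {V : Type*} (κ : V → ℕ) (X : Set (Finset V)) (i : ℕ) : Prop :=
  ∀ φ ∈ cochains X i, coboundary κ X φ = 0 →
    ∃ ψ : Finset V → ℂ, (∀ F, ψ F ≠ 0 → F ∈ X ∧ F.card + 1 = i) ∧ coboundary κ X ψ = φ

variable {V : Type*} {κ : V → ℕ} {X A B : Set (Finset V)} {i : ℕ}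

theorem coboundary_apply_of_mem [DecidableEq V] (φ : Finset V → ℂ) {F : Finset V} (h : F ∈ X) :
    coboundary κ X φ F = ∑ I ∈ F, incidence κ F I * φ (F.erase I) := by
  rw [coboundary, LinearMap.coe_mk, AddHom.coe_mk, if_pos h]
  congr!

theorem coboundary_apply_of_notMem (φ : Finset V → ℂ) {F : Finset V} (h : F ∉ X) :
    coboundary κ X φ F = 0 := by
  simp [coboundary, h]

theorem coboundary_mem_cochains {φ : Finset V → ℂ} (hφ : ∀ F, φ F ≠ 0 → F.card + 1 = i) :
    coboundary κ X φ ∈ cochains X i := by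
  classical
  intro F h
  have hF : F ∈ X := by
    by_contra hF
    exact h (coboundary_apply_of_notMem φ hF)
  refine ⟨hF, ?_⟩
  rw [coboundary_apply_of_mem φ hF] at h
  obtain ⟨I, hI, h0⟩ := Finset.exists_ne_zero_of_sum_ne_zero h
  rw [← hφ _ (right_ne_zero_of_mul h0), Finset.card_erase_add_one hI]

open Classical in
theorem incidence_erase_of_lt {F : Finset V} {I J : V} (h : κ J < κ I) :
    incidence κ (F.erase I) J = incidence κ F J := by
  unfold incidence
  congr 2
  ext K
  simp only [Finset.mem_filter, Finset.mem_erase]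
  refine ⟨fun hK => ⟨hK.1.2, hK.2⟩, fun hK => ⟨⟨?_, hK.1⟩, hK.2⟩⟩
  rintro rfl
  omega

open Classical in
theorem incidence_erase_of_gt {F : Finset V} {I J : V} (hJ : J ∈ F) (h : κ J < κ I) :
    incidence κ (F.erase J) I = -incidence κ F I := by
  unfold incidence
  rw [Finset.filter_erase, ← Finset.card_erase_add_one (Finset.mem_filter.2 ⟨hJ, h⟩), pow_succ]
  ring

-- Deleting the vertex of smaller color shifts the position of the other by one, while deleting the
-- one of larger color changes nothing.
open Classical in
theorem incidence_mul_incidence_erase {F : Finset V} (hκ : Set.InjOn κ F) {I J : V}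
    (hI : I ∈ F) (hJ : J ∈ F) (h : I ≠ J) :
    incidence κ F I * incidence κ (F.erase I) J =
      -(incidence κ F J * incidence κ (F.erase J) I) := by
  rcases lt_or_gt_of_ne (fun e => h (hκ hI hJ e)) with hlt | hlt
  · rw [incidence_erase_of_gt hI hlt, incidence_erase_of_lt hlt]
    ring
  · rw [incidence_erase_of_gt hJ hlt, incidence_erase_of_lt hlt]
    ring

/-- Order-convexity supplies every intermediate face, so cutting off outside `X` loses no term, and
the two orders of removing a pair of vertices cancel. -/
theorem coboundary_coboundary (hX : X.OrdConnected) (hκ : ∀ F ∈ X, Set.InjOn κ F)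
    {φ : Finset V → ℂ} (hφ : ∀ F, φ F ≠ 0 → F ∈ X) :
    coboundary κ X (coboundary κ X φ) = 0 := by
  classical
  funext F
  by_cases hF : F ∈ X
  swap
  · exact coboundary_apply_of_notMem _ hF
  have key : coboundary κ X (coboundary κ X φ) F = ∑ I ∈ F, ∑ J ∈ F,
      if I = J then 0 else incidence κ F I * incidence κ (F.erase I) J *
        φ ((F.erase I).erase J) := by
    rw [coboundary_apply_of_mem _ hF]
    refine Finset.sum_congr rfl fun I hI => ?_
    have h1 : coboundary κ X φ (F.erase I) =
        ∑ J ∈ F.erase I, incidence κ (F.erase I) J * φ ((F.erase I).erase J) := by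
      by_cases h : F.erase I ∈ X
      · exact coboundary_apply_of_mem _ h
      · rw [coboundary_apply_of_notMem _ h]
        refine (Finset.sum_eq_zero fun J hJ => ?_).symm
        have : φ ((F.erase I).erase J) = 0 := by
          by_contra h0
          exact h (hX.out (hφ _ h0) hF ⟨Finset.erase_subset _ _, Finset.erase_subset _ _⟩)
        rw [this, mul_zero]
    rw [h1, Finset.mul_sum, ← Finset.sum_subset (Finset.erase_subset I F)]
    · refine Finset.sum_congr rfl fun J hJ => ?_
      rw [if_neg (Finset.ne_of_mem_erase hJ).symm, mul_assoc]
    · intro J hJ hJ'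
      rw [if_pos]
      by_contra h
      exact hJ' (Finset.mem_erase.2 ⟨fun e => h e.symm, hJ⟩)
  have anti : coboundary κ X (coboundary κ X φ) F =
      -coboundary κ X (coboundary κ X φ) F := by
    conv_rhs => rw [key, Finset.sum_comm]
    rw [key, ← Finset.sum_neg_distrib]
    refine Finset.sum_congr rfl fun I hI => ?_
    rw [← Finset.sum_neg_distrib]
    refine Finset.sum_congr rfl fun J hJ => ?_
    by_cases h : I = J
    · simp [h]
    · rw [if_neg h, if_neg (Ne.symm h), incidence_mul_incidence_erase (hκ F hF) hI hJ h,
        Finset.erase_right_comm]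
      ring
  exact self_eq_neg.1 anti

/-- `X` is the disjoint union of an upper part `A` and its complement `B`. -/
structure IsUpperPart (X A B : Set (Finset V)) : Prop where
  union_eq : A ∪ B = X
  disjoint : Disjoint A B
  upper : ∀ F ∈ A, ∀ F' ∈ X, F ⊆ F' → F' ∈ A

/-! ### The long exact sequence of an upper part and its complement -/

namespace IsUpperPart

theorem left_subset (h : IsUpperPart X A B) : A ⊆ X := h.union_eq ▸ Set.subset_union_left

theorem right_subset (h : IsUpperPart X A B) : B ⊆ X := h.union_eq ▸ Set.subset_union_right

theorem mem_right (h : IsUpperPart X A B) {F : Finset V} (hF : F ∈ X) (hA : F ∉ A) : F ∈ B := by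
  rw [← h.union_eq] at hF
  exact hF.resolve_left hA

theorem notMem_left (h : IsUpperPart X A B) {F : Finset V} (hF : F ∈ B) : F ∉ A :=
  fun hA => h.disjoint.le_bot ⟨hA, hF⟩

/-- The coboundary only enlarges faces and `A` is closed upwards in `X`, so the cochains on `A` form
a subcomplex. -/
theorem coboundary_left (h : IsUpperPart X A B) {φ : Finset V → ℂ}
    (hφ : ∀ F, φ F ≠ 0 → F ∈ A) : coboundary κ X φ = coboundary κ A φ := by
  classical
  funext F
  by_cases hA : F ∈ A
  · rw [coboundary_apply_of_mem _ hA, coboundary_apply_of_mem _ (h.left_subset hA)]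
  rw [coboundary_apply_of_notMem _ hA]
  by_cases hX : F ∈ X
  · rw [coboundary_apply_of_mem _ hX]
    refine Finset.sum_eq_zero fun I hI => ?_
    have : φ (F.erase I) = 0 := by
      by_contra h0
      exact hA (h.upper _ (hφ _ h0) F hX (Finset.erase_subset _ _))
    rw [this, mul_zero]
  · exact coboundary_apply_of_notMem _ hX

/-- The cochains on `B` form the quotient complex: no subface of a face in `B` lies in `A`, so
values on `A` do not enter. -/
theorem coboundary_right (h : IsUpperPart X A B) {φ ψ : Finset V → ℂ}
    (hφ : ∀ F, φ F ≠ 0 → F ∈ X) (hψ : ∀ F, ψ F ≠ 0 → F ∈ B) (hφψ : ∀ F ∈ B, ψ F = φ F)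
    {F : Finset V} (hF : F ∈ B) : coboundary κ B ψ F = coboundary κ X φ F := by
  classical
  rw [coboundary_apply_of_mem _ hF, coboundary_apply_of_mem _ (h.right_subset hF)]
  refine Finset.sum_congr rfl fun I hI => ?_
  congr 1
  by_cases hB : F.erase I ∈ B
  · exact hφψ _ hB
  have h1 : ψ (F.erase I) = 0 := by
    by_contra h0
    exact hB (hψ _ h0)
  have h2 : φ (F.erase I) = 0 := by
    by_contra h0
    by_cases hA : F.erase I ∈ A
    · exact h.notMem_left hF (h.upper _ hA F (h.right_subset hF) (Finset.erase_subset _ _))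
    · exact hB (h.mem_right (hφ _ h0) hA)
  rw [h1, h2]

/-- If the restriction of `φ` to `B` is the coboundary of `η` in `B`, then `φ` is cohomologous
to a cochain supported on `A`. -/
theorem sub_coboundary_ne_zero (h : IsUpperPart X A B) {φ η : Finset V → ℂ}
    (hφ : ∀ F, φ F ≠ 0 → F ∈ X) (hη : ∀ F, η F ≠ 0 → F ∈ B)
    (hφη : ∀ F ∈ B, coboundary κ B η F = φ F) {F : Finset V}
    (hF : (φ - coboundary κ X η) F ≠ 0) : F ∈ A := by
  have hX : F ∈ X := by
    by_contra hX
    refine hF ?_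
    have : φ F = 0 := by
      by_contra h0
      exact hX (hφ _ h0)
    simp [this, coboundary_apply_of_notMem _ hX]
  by_contra hA
  have hB := h.mem_right hX hA
  refine hF ?_
  rw [Pi.sub_apply, ← hφη F hB, h.coboundary_right (fun F h0 => h.right_subset (hη F h0)) hη
    (fun _ _ => rfl) hB, sub_self]

open Classical in
theorem exists_restriction (h : IsUpperPart X A B) {φ : Finset V → ℂ} {P : Finset V → Prop}
    (hφ : ∀ F, φ F ≠ 0 → F ∈ X ∧ P F) :
    ∃ ψ : Finset V → ℂ, (∀ F, ψ F ≠ 0 → F ∈ B ∧ P F) ∧ (∀ F ∈ B, ψ F = φ F) ∧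
      ∀ F ∈ B, coboundary κ B ψ F = coboundary κ X φ F := by
  refine ⟨fun F => if F ∈ B then φ F else 0, ?_, fun F hF => if_pos hF, fun F hF => ?_⟩
  · intro F hF
    by_cases hB : F ∈ B
    · exact ⟨hB, (hφ F (by simpa [hB] using hF)).2⟩
    · simp [hB] at hF
  · refine h.coboundary_right (fun F h0 => (hφ F h0).1) ?_ (fun F hF => if_pos hF) hF
    intro F hF
    by_contra hB
    simp [hB] at hF

/-- Exactness of H^i(A) → H^i(X) → H^i(B) at the middle term. -/
theorem acyclicAt (h : IsUpperPart X A B) (hX : X.OrdConnected)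
    (hκ : ∀ F ∈ X, Set.InjOn κ F) (hA : AcyclicAt κ A i) (hB : AcyclicAt κ B i) :
    AcyclicAt κ X i := by
  intro φ hφ hδ
  obtain ⟨φB, hφB, hφB', hδB⟩ := h.exists_restriction (κ := κ) hφ
  have hδB' : coboundary κ B φB = 0 := by
    funext F
    by_cases hF : F ∈ B
    · rw [hδB F hF, hδ]
    · exact coboundary_apply_of_notMem _ hF
  obtain ⟨η, hη, hηφ⟩ := hB φB hφB hδB'
  have hηX : ∀ F, η F ≠ 0 → F ∈ X := fun F h0 => h.right_subset (hη F h0).1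
  have hsupp : ∀ F, (φ - coboundary κ X η) F ≠ 0 → F ∈ A := fun F hF =>
    h.sub_coboundary_ne_zero (fun F h0 => (hφ F h0).1) (fun F h0 => (hη F h0).1)
      (fun F hF => by rw [hηφ, hφB' F hF]) hF
  have hdeg : φ - coboundary κ X η ∈ cochains X i :=
    Submodule.sub_mem _ hφ (coboundary_mem_cochains fun F h0 => (hη F h0).2)
  obtain ⟨ζ, hζ, hζφ⟩ := hA (φ - coboundary κ X η)
    (fun F h0 => ⟨hsupp F h0, (hdeg F h0).2⟩) (by
      rw [← h.coboundary_left hsupp, map_sub, hδ, coboundary_coboundary hX hκ hηX, sub_zero])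
  refine ⟨ζ + η, ?_, ?_⟩
  · intro F hF
    by_cases h0 : ζ F = 0
    · have h1 := hη F (by simpa [h0] using hF)
      exact ⟨h.right_subset h1.1, h1.2⟩
    · exact ⟨h.left_subset (hζ F h0).1, (hζ F h0).2⟩
  · rw [map_add, h.coboundary_left fun F h0 => (hζ F h0).1, hζφ, sub_add_cancel]

/-- Exactness of H^{i-1}(B) → H^i(A) → H^i(X): a primitive in `X` is corrected by a coboundary until
it is supported on `A`. -/
theorem acyclicAt_left (h : IsUpperPart X A B) (hX : X.OrdConnected)
    (hκ : ∀ F ∈ X, Set.InjOn κ F) (hXi : AcyclicAt κ X i)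
    (hB : ∀ j, j + 1 = i → AcyclicAt κ B j) : AcyclicAt κ A i := by
  intro φ hφ hδ
  have hδX : coboundary κ X φ = 0 := by
    rw [h.coboundary_left fun F h0 => (hφ F h0).1, hδ]
  obtain ⟨ψ, hψ, hψφ⟩ := hXi φ (fun F h0 => ⟨h.left_subset (hφ F h0).1, (hφ F h0).2⟩) hδX
  -- In degree 0 there is no lower degree in which to correct the primitive, but there the primitive
  -- is zero.
  rcases i with _ | j
  · refine ⟨ψ, fun F h0 => absurd (hψ F h0).2 (by omega), ?_⟩
    have : ψ = 0 := by
      funext F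
      by_contra h0
      exact absurd (hψ F h0).2 (by omega)
    rw [← hψφ, this, map_zero, map_zero]
  obtain ⟨ψB, hψB, hψB', hδB⟩ := h.exists_restriction (κ := κ) hψ
  have hδB' : coboundary κ B ψB = 0 := by
    funext F
    by_cases hF : F ∈ B
    · rw [hδB F hF, hψφ]
      by_contra h0
      exact h.notMem_left hF (hφ F h0).1
    · exact coboundary_apply_of_notMem _ hF
  obtain ⟨η, hη, hηψ⟩ := hB j rfl ψB
    (fun F h0 => ⟨(hψB F h0).1, Nat.succ_injective (hψB F h0).2⟩) hδB'
  have hηX : ∀ F, η F ≠ 0 → F ∈ X := fun F h0 => h.right_subset (hη F h0).1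
  have hsupp : ∀ F, (ψ - coboundary κ X η) F ≠ 0 → F ∈ A := fun F hF =>
    h.sub_coboundary_ne_zero (fun F h0 => (hψ F h0).1) (fun F h0 => (hη F h0).1)
      (fun F hF => by rw [hηψ, hψB' F hF]) hF
  have hdeg : ψ - coboundary κ X η ∈ cochains X j :=
    Submodule.sub_mem _ (fun F h0 => ⟨(hψ F h0).1, Nat.succ_injective (hψ F h0).2⟩)
      (coboundary_mem_cochains fun F h0 => (hη F h0).2)
  refine ⟨ψ - coboundary κ X η, fun F h0 => ⟨hsupp F h0, by rw [(hdeg F h0).2]⟩, ?_⟩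
  rw [← h.coboundary_left hsupp, map_sub, hψφ, coboundary_coboundary hX hκ hηX, sub_zero]

end IsUpperPart

/-- A nonempty simplex is acyclic. -/
theorem acyclicAt_simplex {L : Finset V} (hL : L.Nonempty) (hκ : Set.InjOn κ L) :
    AcyclicAt κ {F | F ⊆ L} i := by
  classical
  intro φ hφ hδ
  obtain ⟨I₀, hI₀, hmin⟩ := L.exists_min_image κ hL
  have hlt : ∀ I ∈ L, I ≠ I₀ → κ I₀ < κ I := fun I hI h =>
    lt_of_le_of_ne (hmin I hI) fun e => h (hκ hI hI₀ e.symm)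
  -- Contraction of the cone with apex `I₀`. The apex has the least color, so its incidence sign is
  -- always 1.
  refine ⟨fun F => if I₀ ∈ F then 0 else φ (insert I₀ F), ?_, ?_⟩
  · intro F hF
    by_cases h0 : I₀ ∈ F
    · simp [h0] at hF
    · have := hφ _ (by simpa [h0] using hF)
      rw [Finset.card_insert_of_notMem h0] at this
      exact ⟨(Finset.subset_insert _ _).trans this.1, this.2⟩
  funext F
  by_cases hF : F ⊆ L
  swap
  · rw [coboundary_apply_of_notMem _ hF]
    by_contra h0
    exact hF (hφ F (Ne.symm h0)).1
  rw [coboundary_apply_of_mem _ (show F ∈ {F | F ⊆ L} from hF)]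
  by_cases h0 : I₀ ∈ F
  · rw [Finset.sum_eq_single I₀]
    · have : incidence κ F I₀ = 1 := by
        unfold incidence
        rw [Finset.filter_false_of_mem fun J hJ => not_lt.2 (hmin J (hF hJ))]
        simp
      simp [this, Finset.insert_erase h0]
    · intro I hI hne
      simp [h0, hne.symm]
    · exact fun h => absurd h0 h
  · have hins : insert I₀ F ⊆ L := Finset.insert_subset hI₀ hF
    -- The cocycle condition on `insert I₀ F` expresses `φ F` by the other terms, whose signs flip
    -- when `I₀` is removed.
    have hδF := congrFun hδ (insert I₀ F)
    rw [coboundary_apply_of_mem _ (show insert I₀ F ∈ {F | F ⊆ L} from hins),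
      Finset.sum_insert h0, Finset.erase_insert h0] at hδF
    have h1 : incidence κ (insert I₀ F) I₀ = 1 := by
      unfold incidence
      rw [Finset.filter_false_of_mem fun J hJ => not_lt.2 (hmin J (hins hJ))]
      simp
    rw [h1, one_mul, Pi.zero_apply] at hδF
    rw [eq_neg_of_add_eq_zero_left hδF, ← Finset.sum_neg_distrib]
    refine Finset.sum_congr rfl fun I hI => ?_
    have hne : I ≠ I₀ := fun e => h0 (e ▸ hI)
    have h2 := incidence_erase_of_gt (Finset.mem_insert_self I₀ F) (hlt I (hF hI) hne)
    rw [Finset.erase_insert h0] at h2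
    have h3 : I₀ ∉ F.erase I := fun h => h0 (Finset.mem_of_mem_erase h)
    rw [if_neg h3, h2, Finset.erase_insert_of_ne hne.symm]
    ring

end ColoredComplex

/-! ### Classes of the preorder generated by a relation -/

section Classes

open Relation

variable {N : Type*}

/-- The relation `r` together with the pair `(u, v)`. -/
def addPair (r : N → N → Prop) (u v : N) : N → N → Prop := fun x y => r x y ∨ (x = u ∧ y = v)

/-- The equivalence relation of the preorder generated by `r`. -/
def classSetoid (r : N → N → Prop) : Setoid N where
  r x y := ReflTransGen r x y ∧ ReflTransGen r y x
  iseqv :=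
    { refl := fun _ => ⟨.refl, .refl⟩
      symm := fun h => ⟨h.2, h.1⟩
      trans := fun h h' => ⟨h.1.trans h'.1, h'.2.trans h.2⟩ }

/-- The number of equivalence classes of the preorder generated by `r`. -/
noncomputable def numClasses (r : N → N → Prop) : ℕ := Nat.card (Quotient (classSetoid r))

theorem classSetoid_iff {r : N → N → Prop} {x y : N} :
    (classSetoid r) x y ↔ ReflTransGen r x y ∧ ReflTransGen r y x := Iff.rfl

/-- A path need use the new pair only once: whatever lies between its first and last use can be cut
out. -/
theorem reflTransGen_addPair {r : N → N → Prop} {u v x y : N} :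
    ReflTransGen (addPair r u v) x y ↔
      ReflTransGen r x y ∨ (ReflTransGen r x u ∧ ReflTransGen r v y) := by
  constructor
  · intro h
    induction h with
    | refl => exact Or.inl .refl
    | tail _ hab ih =>
      rcases hab with hab | ⟨rfl, rfl⟩
      · rcases ih with ih | ih
        · exact Or.inl (ih.tail hab)
        · exact Or.inr ⟨ih.1, ih.2.tail hab⟩
      · rcases ih with ih | ih
        · exact Or.inr ⟨ih, .refl⟩
        · exact Or.inr ⟨ih.1, .refl⟩
  · have hmono : ∀ {a b}, ReflTransGen r a b → ReflTransGen (addPair r u v) a b :=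
      fun h => ReflTransGen.mono (fun _ _ h => Or.inl h) _ _ h
    rintro (h | ⟨h, h'⟩)
    · exact hmono h
    · exact ((hmono h).tail (Or.inr ⟨rfl, rfl⟩)).trans (hmono h')

variable [Finite N]

theorem numClasses_le_of_imp {r r' : N → N → Prop}
    (h : ∀ x y, (classSetoid r') x y → (classSetoid r) x y) : numClasses r ≤ numClasses r' := by
  refine Nat.card_le_card_of_surjective
    (Quotient.map' (s₁ := classSetoid r') (s₂ := classSetoid r) id h) fun q => ?_
  induction q using Quotient.inductionOn with
  | h x => exact ⟨Quotient.mk _ x, rfl⟩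

/-- If passing from `r` to `r'` can only join the classes of `u` and `v`, at most one class is
lost. -/
theorem numClasses_le_add_one {r r' : N → N → Prop} (u v : N)
    (h : ∀ x y, (classSetoid r') x y → (classSetoid r) x y ∨
      (((classSetoid r) x u ∨ (classSetoid r) x v) ∧
        ((classSetoid r) y u ∨ (classSetoid r) y v))) :
    numClasses r ≤ numClasses r' + 1 := by
  classical
  -- The class of `v` is sent to `none`. Two of the remaining classes can merge only if both are the
  -- class of `u`.
  have hinj : Function.Injective (fun q : Quotient (classSetoid r) =>
      if (classSetoid r) q.out v then none else
        (some (Quotient.mk _ q.out) : Option (Quotient (classSetoid r')))) := by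
    intro p q hpq
    have key : (classSetoid r) p.out q.out := by
      by_cases hp : (classSetoid r) p.out v <;> by_cases hq : (classSetoid r) q.out v
      · exact (classSetoid r).trans hp ((classSetoid r).symm hq)
      · simp [hp, hq] at hpq
      · simp [hp, hq] at hpq
      · simp only [hp, hq, if_false, Option.some.injEq] at hpq
        rcases h _ _ (Quotient.exact hpq) with h1 | ⟨h1, h2⟩
        · exact h1
        · exact (classSetoid r).trans (h1.resolve_right hp)
            ((classSetoid r).symm (h2.resolve_right hq))
    rw [← p.out_eq, ← q.out_eq]
    exact Quotient.sound key
  have := Nat.card_le_card_of_injective _ hinj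
  rwa [Finite.card_option] at this

/-- The pair (u, v) closes a new cycle only if `v` already reaches `u`, so no classes merge. -/
theorem numClasses_le_addPair {r : N → N → Prop} {u v : N} (h : ¬ ReflTransGen r v u) :
    numClasses r ≤ numClasses (addPair r u v) := by
  refine numClasses_le_of_imp fun x y hxy => ?_
  obtain ⟨h1, h2⟩ := classSetoid_iff.1 hxy
  rw [reflTransGen_addPair] at h1 h2
  rcases h1 with h1 | h1 <;> rcases h2 with h2 | h2
  · exact ⟨h1, h2⟩
  · exact absurd ((h2.2.trans h1).trans h2.1) h
  · exact absurd ((h1.2.trans h2).trans h1.1) h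
  · exact absurd (h1.2.trans h2.1) h

/-- Adding a pair `(v, u)` to a relation loses at most one class if nothing lies strictly between
`u` and `v`. -/
theorem numClasses_le_addPair_add_one {r : N → N → Prop} {u v : N}
    (h : ∀ x, ReflTransGen r u x → ReflTransGen r x v →
      (classSetoid r) x u ∨ (classSetoid r) x v) :
    numClasses r ≤ numClasses (addPair r v u) + 1 := by
  refine numClasses_le_add_one u v fun x y hxy => ?_
  obtain ⟨h1, h2⟩ := classSetoid_iff.1 hxy
  rw [reflTransGen_addPair] at h1 h2
  rcases h1 with h1 | h1 <;> rcases h2 with h2 | h2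
  · exact Or.inl ⟨h1, h2⟩
  · exact Or.inr ⟨h x h2.2 (h1.trans h2.1), h y (h2.2.trans h1) h2.1⟩
  · exact Or.inr ⟨h x (h1.2.trans h2) h1.1, h y h1.2 (h2.trans h1.1)⟩
  · exact Or.inr ⟨h x h2.2 h1.1, h y h1.2 h2.1⟩

end Classes

/-! ### Chains of closed sets -/

section Faces

open Relation ColoredComplex

variable {N : Type*}

/-- The chains of sets with cardinality in `S` that are closed under predecessors for `r` and
separate every pair in `W`. They correspond to the functions `f` on `N`, up to the values taken, that
are weakly increasing along `r`, strictly increasing along `W`, and for which the cardinalities of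
the initial segments are in `S`. -/
def faces (r : N → N → Prop) (W : Finset (N × N)) (S : Finset ℕ) : Set (Finset (Finset N)) :=
  {F | IsChain (· ⊆ ·) (F : Set (Finset N)) ∧
    (∀ I ∈ F, I.card ∈ S ∧ ∀ u v, r u v → v ∈ I → u ∈ I) ∧
    ∀ p ∈ W, ∃ I ∈ F, p.1 ∈ I ∧ p.2 ∉ I}

variable {r : N → N → Prop} {W : Finset (N × N)} {S : Finset ℕ}

theorem injOn_card_of_isChain {F : Set (Finset N)} (h : IsChain (· ⊆ ·) F) :
    Set.InjOn Finset.card F := by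
  intro I hI J hJ e
  rcases h.total hI hJ with h1 | h1
  · exact Finset.eq_of_subset_of_card_le h1 e.ge
  · exact (Finset.eq_of_subset_of_card_le h1 e.le).symm

theorem injOn_card_of_mem_faces {F : Finset (Finset N)} (hF : F ∈ faces r W S) :
    Set.InjOn Finset.card (F : Set (Finset N)) :=
  injOn_card_of_isChain hF.1

theorem ordConnected_faces : (faces r W S).OrdConnected := by
  refine ⟨fun F hF F'' hF'' F' hF' => ⟨?_, fun I hI => hF''.2.1 I (hF'.2 hI), fun p hp => ?_⟩⟩
  · exact hF''.1.mono (Finset.coe_subset.2 hF'.2)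
  · obtain ⟨I, hI, h⟩ := hF.2.2 p hp
    exact ⟨I, hF'.1 hI, h⟩

/-- A chain fails to separate `u` from `v` exactly when each member containing `u` contains `v`,
which is closure under the extra pair (v, u). Separation persists when members are added. -/
theorem isUpperPart_faces [DecidableEq N] (u v : N) :
    IsUpperPart (faces r W S) (faces r (insert (u, v) W) S) (faces (addPair r v u) W S) := by
  refine ⟨Set.Subset.antisymm ?_ ?_, ?_, ?_⟩
  · rintro F (hF | hF)
    · exact ⟨hF.1, hF.2.1, fun p hp => hF.2.2 p (Finset.mem_insert_of_mem hp)⟩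
    · exact ⟨hF.1, fun I hI => ⟨(hF.2.1 I hI).1, fun a b h => (hF.2.1 I hI).2 a b (Or.inl h)⟩,
        hF.2.2⟩
  · intro F hF
    by_cases h : ∃ I ∈ F, u ∈ I ∧ v ∉ I
    · refine Or.inl ⟨hF.1, hF.2.1, fun p hp => ?_⟩
      rcases Finset.mem_insert.1 hp with rfl | hp
      · exact h
      · exact hF.2.2 p hp
    · refine Or.inr ⟨hF.1, fun I hI => ⟨(hF.2.1 I hI).1, ?_⟩, hF.2.2⟩
      rintro a b (hab | ⟨rfl, rfl⟩) hb
      · exact (hF.2.1 I hI).2 a b hab hb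
      · by_contra ha
        exact h ⟨I, hI, hb, ha⟩
  · rw [Set.disjoint_left]
    intro F hF hF'
    obtain ⟨I, hI, hu, hv⟩ := hF.2.2 (u, v) (Finset.mem_insert_self _ _)
    exact hv ((hF'.2.1 I hI).2 v u (Or.inr ⟨rfl, rfl⟩) hu)
  · intro F hF F' hF' hsub
    refine ⟨hF'.1, hF'.2.1, fun p hp => ?_⟩
    obtain ⟨I, hI, h⟩ := hF.2.2 p hp
    exact ⟨I, hsub hI, h⟩

/-- A member containing `v` is not contained in the member that separates `u` from `v`, so it
contains that member and hence `u`. -/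
theorem faces_addPair_of_mem {u v : N} (h : (u, v) ∈ W) :
    faces (addPair r u v) W S = faces r W S := by
  ext F
  refine ⟨fun hF => ⟨hF.1, fun I hI => ⟨(hF.2.1 I hI).1, fun a b h =>
    (hF.2.1 I hI).2 a b (Or.inl h)⟩, hF.2.2⟩,
    fun hF => ⟨hF.1, fun I hI => ⟨(hF.2.1 I hI).1, ?_⟩, hF.2.2⟩⟩
  rintro a b (hab | ⟨rfl, rfl⟩) hb
  · exact (hF.2.1 I hI).2 a b hab hb
  · obtain ⟨J, hJ, ha', hb'⟩ := hF.2.2 _ h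
    rcases hF.1.total hI hJ with h1 | h1
    · exact absurd (h1 hb) hb'
    · exact h1 ha'

theorem mem_of_reflTransGen {I : Finset N} (hI : ∀ u v, r u v → v ∈ I → u ∈ I) {x y : N}
    (h : ReflTransGen r x y) (hy : y ∈ I) : x ∈ I := by
  induction h with
  | refl => exact hy
  | tail _ hab ih => exact ih (hI _ _ hab hy)

variable [Fintype N]

/-- Closed sets of a total preorder form a chain, so the complex is a full simplex. It has a vertex
by pigeonhole: the principal down-sets have `numClasses r` distinct sizes in [1, n], too many to
avoid `S`. -/
theorem acyclicAt_faces_of_total (hS : S ⊆ Finset.Icc 1 (Fintype.card N))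
    (hr : ∀ x y, ReflTransGen r x y ∨ ReflTransGen r y x) {i : ℕ}
    (hi : i + Fintype.card N < S.card + numClasses r) :
    AcyclicAt Finset.card (faces r ∅ S) i := by
  classical
  set L : Finset (Finset N) :=
    Finset.univ.filter fun I => I.card ∈ S ∧ ∀ u v, r u v → v ∈ I → u ∈ I with hLdef
  have hchain : IsChain (· ⊆ ·) (L : Set (Finset N)) := by
    intro I hI J hJ _
    have hI := (Finset.mem_filter.1 hI).2.2
    have hJ := (Finset.mem_filter.1 hJ).2.2
    by_contra hcon
    simp only [not_or, Finset.not_subset] at hcon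
    obtain ⟨⟨x, hx, hx'⟩, y, hy, hy'⟩ := hcon
    rcases hr x y with h | h
    · exact hx' (mem_of_reflTransGen hJ h hy)
    · exact hy' (mem_of_reflTransGen hI h hx)
  have hfaces : faces r ∅ S = {F | F ⊆ L} := by
    ext F
    refine ⟨fun hF I hI => Finset.mem_filter.2 ⟨Finset.mem_univ _, hF.2.1 I hI⟩,
      fun hF => ⟨hchain.mono (Finset.coe_subset.2 hF),
        fun I hI => (Finset.mem_filter.1 (hF hI)).2, by simp⟩⟩
  let down : N → Finset N := fun x => Finset.univ.filter fun y => ReflTransGen r y x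
  have hdown : ∀ x, ∀ u v, r u v → v ∈ down x → u ∈ down x := by
    intro x u v huv hv
    simp only [down, Finset.mem_filter, Finset.mem_univ, true_and] at hv ⊢
    exact hv.head huv
  have hself : ∀ x, x ∈ down x := fun x => by simp [down, ReflTransGen.refl]
  let Q : Finset ℕ := Finset.univ.image fun x => (down x).card
  have hQ : numClasses r ≤ Q.card := by
    have hcard : ∀ x y, ReflTransGen r x y → (down x).card = (down y).card →
        ReflTransGen r y x := by
      intro x y hxy hc
      have hsub : down x ⊆ down y := fun z hz => by
        simp only [down, Finset.mem_filter, Finset.mem_univ, true_and] at hz ⊢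
        exact hz.trans hxy
      have := Finset.eq_of_subset_of_card_le hsub hc.ge
      have hy := hself y
      rw [← this] at hy
      simpa [down] using hy
    have hinj : Function.Injective (fun q : Quotient (classSetoid r) =>
        (⟨(down q.out).card, Finset.mem_image_of_mem _ (Finset.mem_univ _)⟩ : Q)) := by
      intro p q hpq
      have hc : (down p.out).card = (down q.out).card := congrArg Subtype.val hpq
      rw [← p.out_eq, ← q.out_eq]
      refine Quotient.sound ?_
      rcases hr p.out q.out with h | h
      · exact ⟨h, hcard _ _ h hc⟩
      · exact ⟨hcard _ _ h hc.symm, h⟩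
    have := Nat.card_le_card_of_injective _ hinj
    rwa [Nat.card_eq_fintype_card (α := Q), Fintype.card_coe] at this
  have hQS : Q ∪ S ⊆ Finset.Icc 1 (Fintype.card N) := by
    refine Finset.union_subset ?_ hS
    intro k hk
    obtain ⟨x, -, rfl⟩ := Finset.mem_image.1 hk
    exact Finset.mem_Icc.2 ⟨Finset.card_pos.2 ⟨x, hself x⟩, Finset.card_le_univ _⟩
  have hne : (Q ∩ S).Nonempty := by
    rw [← Finset.card_pos]
    have h1 := Finset.card_union_add_card_inter Q S
    have h2 := Finset.card_le_card hQS
    rw [Nat.card_Icc] at h2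
    omega
  have hL : L.Nonempty := by
    obtain ⟨k, hk⟩ := hne
    obtain ⟨hkQ, hkS⟩ := Finset.mem_inter.1 hk
    obtain ⟨x, -, rfl⟩ := Finset.mem_image.1 hkQ
    exact ⟨down x, Finset.mem_filter.2 ⟨Finset.mem_univ _, hkS, hdown x⟩⟩
  rw [hfaces]
  exact acyclicAt_simplex hL (injOn_card_of_isChain hchain)

/-- Induction on the number of unrelated ordered pairs. For incomparable `u`, `v`, the chains not
separating `v` from `u` belong to r + (u, v). Those separating them are an upper part of the chains
for r + (v, u), with complement given by adding both pairs. Only this last relation may lose a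
class, and it is needed one degree lower. -/
theorem acyclicAt_faces_empty (hS : S ⊆ Finset.Icc 1 (Fintype.card N)) (r : N → N → Prop) {i : ℕ}
    (hi : i + Fintype.card N < S.card + numClasses r) :
    AcyclicAt Finset.card (faces r ∅ S) i := by
  classical
  let gap : (N → N → Prop) → ℕ := fun r =>
    (Finset.univ.filter fun p : N × N => ¬ ReflTransGen r p.1 p.2).card
  have hgap : ∀ (r : N → N → Prop) (u v : N), ¬ ReflTransGen r u v →
      gap (addPair r u v) < gap r := by
    intro r u v h
    refine Finset.card_lt_card (Finset.ssubset_iff_of_subset ?_ |>.2 ⟨(u, v), ?_, ?_⟩)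
    · intro p hp
      simp only [Finset.mem_filter, Finset.mem_univ, true_and, reflTransGen_addPair, not_or] at hp ⊢
      exact hp.1
    · simpa using h
    · simp [reflTransGen_addPair, ReflTransGen.refl]
  induction hk : gap r using Nat.strong_induction_on generalizing r i with
  | _ k ih =>
    by_cases htot : ∀ x y, ReflTransGen r x y ∨ ReflTransGen r y x
    · exact acyclicAt_faces_of_total hS htot hi
    push Not at htot
    obtain ⟨u, v, huv, hvu⟩ := htot
    have hup : IsUpperPart (faces r ∅ S) (faces r {(v, u)} S) (faces (addPair r u v) ∅ S) :=
      isUpperPart_faces v u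
    have hup' : IsUpperPart (faces (addPair r v u) ∅ S) (faces r {(v, u)} S)
        (faces (addPair (addPair r v u) u v) ∅ S) := by
      -- Once `v` is separated from `u`, the pair (v, u) can be added to the relation for free,
      -- which embeds the same upper part in a second complex.
      rw [← faces_addPair_of_mem (r := r) (Finset.mem_singleton_self (v, u))]
      exact isUpperPart_faces v u
    have huv' : ¬ ReflTransGen (addPair r v u) u v := by
      rw [reflTransGen_addPair]
      rintro (h | h)
      · exact huv h
      · exact huv h.1
    have hc1 := numClasses_le_addPair hvu
    have hc2 := numClasses_le_addPair huv
    -- As `u` and `v` were incomparable, nothing lies strictly between `v` and `u` after (v, u) is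
    -- added.
    have hc3 : numClasses (addPair r v u) ≤ numClasses (addPair (addPair r v u) u v) + 1 := by
      refine numClasses_le_addPair_add_one fun x h1 h2 => ?_
      rw [classSetoid_iff, classSetoid_iff]
      simp only [reflTransGen_addPair] at h1 h2 ⊢
      rcases h1 with h1 | h1 <;> rcases h2 with h2 | h2
      · exact absurd (h1.trans h2) hvu
      · exact Or.inl ⟨Or.inl h2.1, Or.inl h1⟩
      · exact Or.inr ⟨Or.inl h2, Or.inl h1.2⟩
      · exact absurd (h1.2.trans h2.1) huv
    have hA : AcyclicAt Finset.card (faces r {(v, u)} S) i := by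
      refine hup'.acyclicAt_left ordConnected_faces (fun F => injOn_card_of_mem_faces)
        (ih _ (hk ▸ hgap r v u hvu) _ (by omega) rfl) fun j hj => ?_
      exact ih _ (hk ▸ (hgap _ u v huv').trans (hgap r v u hvu)) _ (by omega) rfl
    exact hup.acyclicAt ordConnected_faces (fun F => injOn_card_of_mem_faces) hA
      (ih _ (hk ▸ hgap r u v huv) _ (by omega) rfl)

/-- The vanishing theorem: if adding the reverses of few pairs from `W` to `r` joins as few classes
as possible, then the cohomology of `faces r W S` vanishes in low degrees. -/
theorem acyclicAt_faces (hS : S ⊆ Finset.Icc 1 (Fintype.card N)) (r : N → N → Prop)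
    (W : Finset (N × N)) {i c : ℕ}
    (hc : ∀ A ⊆ W, A.card ≤ i → c ≤ numClasses (fun x y => r x y ∨ (y, x) ∈ A) + A.card)
    (hi : i + Fintype.card N < S.card + c) :
    AcyclicAt Finset.card (faces r W S) i := by
  classical
  induction W using Finset.induction_on generalizing r i c with
  | empty =>
    refine acyclicAt_faces_empty hS r ?_
    have := hc ∅ (Finset.Subset.refl _) (by simp)
    simp only [Finset.notMem_empty, or_false, Finset.card_empty, add_zero] at this
    change c ≤ numClasses r at this
    omega
  | insert e W _ ih =>
    obtain ⟨u, v⟩ := e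
    refine (isUpperPart_faces u v).acyclicAt_left ordConnected_faces
      (fun F => injOn_card_of_mem_faces)
      (ih r (fun A hA => hc A (hA.trans (Finset.subset_insert _ _))) hi) fun j hj => ?_
    -- The reversed pair (u, v) has moved from `A` into the relation. This costs 1 in the bound `c`,
    -- and the drop from `i` to `j` pays for it.
    refine ih (addPair r v u) (c := c - 1) (fun A hA hAj => ?_) (by omega)
    have hle := Finset.card_insert_le (u, v) A
    have := hc (insert (u, v) A) (Finset.insert_subset_insert _ hA) (by omega)
    have heq : (fun x y => r x y ∨ (y, x) ∈ insert (u, v) A) =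
        fun x y => addPair r v u x y ∨ (y, x) ∈ A := by
      funext x y
      simp only [addPair, Finset.mem_insert, Prod.mk.injEq, eq_iff_iff]
      tauto
    rw [heq] at this
    omega

end Faces

/-! ### Paths and mixed cycles -/

section Paths

open Relation

variable {N : Type*} {r : N → N → Prop}

theorem reflTransGen_of_steps {p : ℕ → N} {k : ℕ} (hp : ∀ i < k, r (p i) (p (i + 1))) {i j : ℕ}
    (hij : i ≤ j) (hj : j ≤ k) : ReflTransGen r (p i) (p j) := by
  induction j, hij using Nat.le_induction with
  | base => exact .refl
  | succ j _ ih => exact (ih (by omega)).tail (hp j (by omega))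

theorem exists_steps_of_reflTransGen {x y : N} (h : ReflTransGen r x y) :
    ∃ (k : ℕ) (p : ℕ → N), p 0 = x ∧ p k = y ∧ ∀ i < k, r (p i) (p (i + 1)) := by
  induction h with
  | refl => exact ⟨0, fun _ => x, rfl, rfl, fun i hi => absurd hi (by omega)⟩
  | @tail b c _ hbc ih =>
    obtain ⟨k, p, h0, hk, hp⟩ := ih
    refine ⟨k + 1, fun i => if i ≤ k then p i else c, by simp [h0], by simp, fun i hi => ?_⟩
    by_cases hik : i + 1 ≤ k
    · simpa [hik, (by omega : i ≤ k)] using hp i (by omega)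
    · obtain rfl : i = k := by omega
      simpa [hk] using hbc

/-- If some `x` lies strictly between `u` and `v`, then there is a path from `u` to `v` with
distinct vertices and at least two steps. -/
theorem exists_path_of_between {u v x : N} (hux : ReflTransGen r u x) (hxv : ReflTransGen r x v)
    (hu : ¬ (classSetoid r) x u) (hv : ¬ (classSetoid r) x v) :
    ∃ (k : ℕ) (p : ℕ → N), p 0 = u ∧ p (k + 2) = v ∧ (∀ i < k + 2, r (p i) (p (i + 1))) ∧
      Set.InjOn p (Set.Iic (k + 2)) := by
  classical
  -- Minimality is taken among walks visiting a vertex outside the classes of both ends; a shortest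
  -- walk without this condition could be the single step from `u` to `v`.
  let P : ℕ → Prop := fun k => ∃ p : ℕ → N, p 0 = u ∧ p k = v ∧ (∀ i < k, r (p i) (p (i + 1))) ∧
    ∃ j ≤ k, ¬ (classSetoid r) (p j) u ∧ ¬ (classSetoid r) (p j) v
  have hP : ∃ k, P k := by
    obtain ⟨k, p, hp0, hpk, hp⟩ := exists_steps_of_reflTransGen hux
    obtain ⟨l, q, hq0, hql, hq⟩ := exists_steps_of_reflTransGen hxv
    refine ⟨k + l, fun i => if i ≤ k then p i else q (i - k), by simp [hp0], ?_, fun i hi => ?_,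
      k, by omega, by simpa [hpk] using ⟨hu, hv⟩⟩
    · by_cases hl : l = 0
      · subst hl
        simp [hpk, ← hql, hq0]
      · simp [hl, hql]
    · rcases lt_trichotomy i k with h | h | h
      · simpa [h.le, Nat.succ_le_of_lt h] using hp i h
      · subst h
        have := hq 0 (by omega)
        rw [hq0, ← hpk] at this
        simpa using this
      · have := hq (i - k) (by omega)
        rw [← Nat.sub_add_comm h.le] at this
        simpa [h.not_ge, h.not_gt] using this
  obtain ⟨p, hp0, hpk, hp, j, hj, hju, hjv⟩ := Nat.find_spec hP
  have hmin : ∀ m < Nat.find hP, ¬ P m := fun m hm => Nat.find_min hP hm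
  generalize Nat.find hP = k at *
  have hinj : ∀ a b, a < b → b ≤ k → p a ≠ p b := by
    intro a b hab hb heq
    refine hmin (k - (b - a)) (by omega)
      ⟨fun i => if i ≤ a then p i else p (i + (b - a)), by simp [hp0], ?_, fun i hi => ?_, ?_⟩
    · by_cases h : k - (b - a) ≤ a
      · have h1 : b = k := by omega
        have h2 : k - (b - a) = a := by omega
        simp only [h2, le_refl, if_true]
        rw [heq, h1, hpk]
      · simp only [h, if_false]
        rw [← hpk]
        congr 1
        omega
    · rcases lt_trichotomy i a with h | h | h
      · simpa [h.le, Nat.succ_le_of_lt h] using hp i (by omega)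
      · subst h
        have := hp b (by omega)
        rw [← heq] at this
        simpa [(by omega : i + 1 + (b - i) = b + 1)] using this
      · have := hp (i + (b - a)) (by omega)
        rw [Nat.add_right_comm] at this
        simpa [h.not_ge, h.not_gt] using this
    · by_cases h1 : j ≤ a
      · exact ⟨j, by omega, by simpa [h1] using ⟨hju, hjv⟩⟩
      by_cases h2 : b < j
      · refine ⟨j - (b - a), by omega, ?_⟩
        dsimp only
        rw [if_neg (by omega), Nat.sub_add_cancel (by omega)]
        exact ⟨hju, hjv⟩
      -- If the distinguished vertex is on the loop being cut out, `p a` lies on the same closed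
      -- walk, hence in the same class, and replaces it.
      · have hja : (classSetoid r) (p j) (p a) := by
          refine ⟨?_, reflTransGen_of_steps hp (by omega) hj⟩
          rw [heq]
          exact reflTransGen_of_steps hp (by omega) hb
        refine ⟨a, by omega, ?_⟩
        simp only [le_refl, if_true]
        exact ⟨fun h => hju ((classSetoid r).trans hja h),
          fun h => hjv ((classSetoid r).trans hja h)⟩
  have hj0 : j ≠ 0 := by
    rintro rfl
    exact hju (hp0 ▸ (classSetoid r).refl _)
  have hjk : j ≠ k := by
    rintro rfl
    exact hjv (hpk ▸ (classSetoid r).refl _)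
  obtain ⟨l, rfl⟩ : ∃ l, k = l + 2 := ⟨k - 2, by omega⟩
  refine ⟨l, p, hp0, hpk, hp, fun a ha b hb hab => ?_⟩
  rcases lt_trichotomy a b with h | h | h
  · exact absurd hab (hinj a b h hb)
  · exact h
  · exact absurd hab.symm (hinj b a h ha)

end Paths

namespace DoublePoset

open Relation

variable {N : Type*} (D : DoublePoset N)

theorem le₁_of_reflTransGen_covBy₁ {x y : N} (h : ReflTransGen D.covBy₁ x y) : D.le₁ x y := by
  induction h with
  | refl => exact D.ord₁.le_refl _
  | tail _ hab ih => exact D.ord₁.le_trans _ _ _ ih (@le_of_lt _ D.ord₁.toPreorder _ _ hab.1)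

variable [Fintype N]

open Classical in
/-- The pairs `(u, v)` with `u ≺₁ v` and `v ≤₂ u`. -/
noncomputable def strictPairs : Finset (N × N) :=
  Finset.univ.filter fun p => D.covBy₁ p.1 p.2 ∧ D.le₂ p.2 p.1

theorem mem_strictPairs {u v : N} : (u, v) ∈ D.strictPairs ↔ D.covBy₁ u v ∧ D.le₂ v u := by
  simp [strictPairs]

theorem undirected_adj_of_mem {u v : N} (h : (u, v) ∈ D.strictPairs) :
    D.mixedGraph.undirected.Adj u v := by
  have h := D.mem_strictPairs.1 h
  refine (SimpleGraph.fromRel_adj _ _ _).2 ⟨?_, Or.inl h⟩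
  exact @ne_of_lt _ D.ord₁.toPreorder _ _ h.1.1

/-- A pair that is not a covering pair after reversing the pairs in `A` lies on a mixed cycle with
few undirected edges. -/
theorem m_le_of_between {A : Finset (N × N)} (hA : A ⊆ D.strictPairs) {u v x : N}
    (huv : (u, v) ∈ D.strictPairs)
    (hux : ReflTransGen (fun x y => D.covBy₁ x y ∨ (y, x) ∈ A) u x)
    (hxv : ReflTransGen (fun x y => D.covBy₁ x y ∨ (y, x) ∈ A) x v)
    (hu : ¬ (classSetoid fun x y => D.covBy₁ x y ∨ (y, x) ∈ A) x u)
    (hv : ¬ (classSetoid fun x y => D.covBy₁ x y ∨ (y, x) ∈ A) x v) :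
    D.mixedGraph.m ≤ A.card + 1 := by
  classical
  obtain ⟨k, p, hp0, hpk, hp, hinj⟩ := exists_path_of_between hux hxv hu hv
  let w : Fin (k + 3) → N := fun i => p i
  -- The undirected edges are the closing edge from `v` back to `u` and the steps that traverse a
  -- pair of `A` backwards.
  let E : Finset (Fin (k + 3)) :=
    Finset.univ.filter fun i => i = Fin.last (k + 2) ∨ (p (i + 1), p i) ∈ A
  have hsucc : ∀ i : Fin (k + 3), i ≠ Fin.last (k + 2) →
      (i : ℕ) < k + 2 ∧ w (i + 1) = p (i + 1) := by
    intro i hi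
    have hlt : (i : ℕ) < k + 2 := Fin.val_lt_last hi
    refine ⟨hlt, ?_⟩
    change p ((i + 1 : Fin (k + 3)) : ℕ) = _
    rw [Fin.val_add_one_of_lt (Fin.lt_last_iff_ne_last.2 hi)]
  have hcycle : D.mixedGraph.IsMixedCycle w E := by
    refine ⟨?_, ?_, ?_, ?_⟩
    · intro a b hab
      exact Fin.ext (hinj (Nat.lt_succ_iff.1 a.2) (Nat.lt_succ_iff.1 b.2) hab)
    · intro i hi
      by_cases hlast : i = Fin.last (k + 2)
      · subst hlast
        have h1 : w (Fin.last (k + 2)) = v := hpk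
        have h2 : w (Fin.last (k + 2) + 1) = u := by
          rw [Fin.last_add_one]
          exact hp0
        rw [h1, h2]
        exact (D.undirected_adj_of_mem huv).symm
      · rw [(hsucc i hlast).2]
        have := (Finset.mem_filter.1 hi).2.resolve_left hlast
        exact (D.undirected_adj_of_mem (hA this)).symm
    · intro i hi
      have hi' : ¬ (i = Fin.last (k + 2) ∨ (p (i + 1), p i) ∈ A) := fun h =>
        hi (Finset.mem_filter.2 ⟨Finset.mem_univ _, h⟩)
      push Not at hi'
      obtain ⟨hlt, hw⟩ := hsucc i hi'.1
      rw [hw]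
      exact (hp i hlt).resolve_right hi'.2
    -- If every edge were undirected, the path from `u` to `v` would descend in ≤₁, against u <₁ v.
    · by_contra hall
      push Not at hall
      have hdown : ∀ i ≤ k + 2, D.le₁ (p i) (p 0) := by
        intro i
        induction i with
        | zero => exact fun _ => D.ord₁.le_refl _
        | succ i ih =>
          intro hi
          have h1 := hall ⟨i, by omega⟩
          have h2 := (Finset.mem_filter.1 h1).2.resolve_left (by
            intro h
            have := congrArg Fin.val h
            simp at this
            omega)
          have h3 := (D.mem_strictPairs.1 (hA h2)).1.1
          exact D.ord₁.le_trans _ _ _ (@le_of_lt _ D.ord₁.toPreorder _ _ h3) (ih (by omega))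
      have hvu := hdown (k + 2) le_rfl
      rw [hp0, hpk] at hvu
      exact @not_le_of_gt _ D.ord₁.toPreorder _ _ (D.mem_strictPairs.1 huv).1.1 hvu
  -- The vertices are distinct, so each pair of `A` is traversed at most once.
  have hcard : (E.erase (Fin.last (k + 2))).card ≤ A.card := by
    refine Finset.card_le_card_of_injOn (fun i => (p (i + 1), p i)) ?_ ?_
    · intro i hi
      obtain ⟨hne, hi⟩ := Finset.mem_erase.1 hi
      exact (Finset.mem_filter.1 hi).2.resolve_left hne
    · intro a _ b _ hab
      exact Fin.ext (hinj (Nat.lt_succ_iff.1 a.2) (Nat.lt_succ_iff.1 b.2) (Prod.ext_iff.1 hab).2)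
  have hE : E.card ≤ A.card + 1 := by
    have := Finset.pred_card_le_card_erase (s := E) (a := Fin.last (k + 2))
    omega
  have hmem : E.card ∈ D.mixedGraph.mixedCycleCounts := ⟨k, w, E, hcycle, rfl⟩
  rw [MixedGraph.m, if_pos ⟨_, hmem⟩]
  exact (Nat.sInf_le hmem).trans hE

/-- Without reversals the classes are singletons. Each reversal costs at most one class, for
otherwise `m_le_of_between` gives a mixed cycle with fewer than `m` undirected edges. -/
theorem card_le_numClasses_add_card {A : Finset (N × N)} (hA : A ⊆ D.strictPairs)
    (hm : A.card < D.mixedGraph.m) :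
    Fintype.card N ≤ numClasses (fun x y => D.covBy₁ x y ∨ (y, x) ∈ A) + A.card := by
  classical
  induction A using Finset.induction_on with
  | empty =>
    have hinj : Function.Injective (fun x : N =>
        (Quotient.mk (classSetoid fun x y => D.covBy₁ x y ∨ (y, x) ∈ (∅ : Finset (N × N))) x)) := by
      intro x y hxy
      have h := classSetoid_iff.1 (Quotient.exact hxy)
      simp only [Finset.notMem_empty, or_false] at h
      exact D.ord₁.le_antisymm _ _ (D.le₁_of_reflTransGen_covBy₁ h.1)
        (D.le₁_of_reflTransGen_covBy₁ h.2)
    have := Nat.card_le_card_of_injective _ hinj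
    rw [Nat.card_eq_fintype_card] at this
    exact this
  | insert e A he ih =>
    obtain ⟨u, v⟩ := e
    rw [Finset.card_insert_of_notMem he] at hm ⊢
    have hA' : A ⊆ D.strictPairs := (Finset.subset_insert _ _).trans hA
    have heq : (fun x y => D.covBy₁ x y ∨ (y, x) ∈ insert (u, v) A) =
        addPair (fun x y => D.covBy₁ x y ∨ (y, x) ∈ A) v u := by
      funext x y
      simp only [addPair, Finset.mem_insert, Prod.mk.injEq, eq_iff_iff]
      tauto
    have hle := numClasses_le_addPair_add_one
      (r := fun x y => D.covBy₁ x y ∨ (y, x) ∈ A) (u := u) (v := v) fun x hux hxv => by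
        by_contra hcon
        rw [not_or] at hcon
        have := D.m_le_of_between hA' (hA (Finset.mem_insert_self _ _)) hux hxv hcon.1 hcon.2
        omega
    have := ih hA' (by omega)
    rw [heq]
    omega

end DoublePoset

/-! ### Characters of exact complexes -/

section Characters

open LinearMap

/-- A section of `π` and the matching retraction onto `A` split `fV` into two summands, whose traces
are computed by cyclicity. -/
theorem trace_add_trace_of_exact {A V B : Type*} [AddCommGroup A] [Module ℂ A]
    [FiniteDimensional ℂ A] [AddCommGroup V] [Module ℂ V] [FiniteDimensional ℂ V]
    [AddCommGroup B] [Module ℂ B] [FiniteDimensional ℂ B] {ι : A →ₗ[ℂ] V} {π : V →ₗ[ℂ] B}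
    (hι : Function.Injective ι) (hπ : Function.Surjective π) (hex : Function.Exact ι π)
    {fA : A →ₗ[ℂ] A} {fV : V →ₗ[ℂ] V} {fB : B →ₗ[ℂ] B} (hA : ι ∘ₗ fA = fV ∘ₗ ι)
    (hB : π ∘ₗ fV = fB ∘ₗ π) : trace ℂ V fV = trace ℂ A fA + trace ℂ B fB := by
  obtain ⟨s, hs⟩ := π.exists_rightInverse_of_surjective (range_eq_top.2 hπ)
  obtain ⟨q, hq⟩ : ∃ q : V →ₗ[ℂ] A, ι ∘ₗ q = LinearMap.id - s ∘ₗ π := by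
    let e := LinearEquiv.ofInjective ι hι
    have hmem : ∀ x, (LinearMap.id - s ∘ₗ π : V →ₗ[ℂ] V) x ∈ range ι := fun x => by
      refine (hex _).1 ?_
      have := LinearMap.congr_fun hs (π x)
      simp only [comp_apply, id_apply] at this
      simp [this]
    refine ⟨e.symm.toLinearMap ∘ₗ (LinearMap.id - s ∘ₗ π : V →ₗ[ℂ] V).codRestrict (range ι) hmem, ?_⟩
    ext x
    simp [e]
  have hqι : q ∘ₗ ι = LinearMap.id := by
    ext a
    apply hι
    have h1 := LinearMap.congr_fun hq (ι a)
    have h2 : π (ι a) = 0 := (hex _).2 ⟨a, rfl⟩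
    simpa [h2] using h1
  have hsplit : fV = (fV ∘ₗ ι) ∘ₗ q + fV ∘ₗ (s ∘ₗ π) := by
    rw [LinearMap.comp_assoc, hq]
    ext x
    simp
  rw [hsplit, map_add, ← hA, trace_comp_comm', ← LinearMap.comp_assoc, hqι, LinearMap.id_comp,
    ← LinearMap.comp_assoc, trace_comp_comm', ← LinearMap.comp_assoc, hB, LinearMap.comp_assoc, hs,
    LinearMap.comp_id]

theorem Representation.isEffectiveCharacter {G : Type*} [Group G] {Q : Type*} [AddCommGroup Q]
    [Module ℂ Q] [FiniteDimensional ℂ Q] (ρ : Representation ℂ G Q) :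
    IsEffectiveCharacter ρ.character := by
  let e : Q ≃ₗ[ℂ] (Fin (Module.finrank ℂ Q) → ℂ) := (Module.finBasis ℂ Q).equivFun
  refine ⟨_, ⟨⟨fun g => e.conj (ρ g), ?_⟩, ?_⟩, ?_⟩
  · rw [map_one]
    exact e.conj_id
  · intro g h
    change e.conj (ρ (g * h)) = e.conj (ρ g) * e.conj (ρ h)
    rw [map_mul]
    exact e.conj_comp _ _
  · funext g
    exact (trace_conj' (ρ g) e).symm

/-- The Hopf trace argument: exactness below `k` makes the lower terms telescope to minus the
character of the coboundaries in `C k`, so the whole sum is the character of `C k` modulo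
coboundaries. -/
theorem isEffectiveCharacter_of_exact {G : Type*} [Group G] {M : Type*} [AddCommGroup M]
    [Module ℂ M] [FiniteDimensional ℂ M] (ρ : Representation ℂ G M) (C : ℕ → Submodule ℂ M)
    (hC : ∀ i g, C i ≤ (C i).comap (ρ g)) (δ : M →ₗ[ℂ] M) (hδ : ∀ g φ, δ (ρ g φ) = ρ g (δ φ))
    (hδC : ∀ i, ∀ φ ∈ C i, δ φ ∈ C (i + 1)) (hδδ : ∀ i, ∀ φ ∈ C i, δ (δ φ) = 0) (k : ℕ)
    (h0 : 0 < k → ∀ φ ∈ C 0, δ φ = 0 → φ = 0)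
    (hex : ∀ i, i + 1 < k → ∀ φ ∈ C (i + 1), δ φ = 0 → ∃ ψ ∈ C i, δ ψ = φ) :
    IsEffectiveCharacter fun g => ∑ i ∈ Finset.range (k + 1),
      (-1) ^ (k - i) * (ρ.subrepresentation (C i) (hC i)).character g := by
  obtain ⟨B, hB0, hBs⟩ : ∃ B : ℕ → Submodule ℂ M, B 0 = ⊥ ∧ ∀ i, B (i + 1) = (C i).map δ :=
    ⟨fun i => Nat.casesOn i ⊥ fun i => (C i).map δ, rfl, fun _ => rfl⟩
  have hBC : ∀ i, B i ≤ C i := by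
    rintro (_ | i)
    · exact hB0 ▸ bot_le
    · rw [hBs]
      rintro _ ⟨φ, hφ, rfl⟩
      exact hδC i φ hφ
  have hB : ∀ i g, B i ≤ (B i).comap (ρ g) := by
    rintro (_ | i) g
    · exact hB0 ▸ bot_le
    · rw [hBs]
      rintro _ ⟨φ, hφ, rfl⟩
      exact ⟨ρ g φ, hC i g hφ, hδ g φ⟩
  have hker : ∀ i < k, ∀ φ ∈ C i, δ φ = 0 ↔ φ ∈ B i := by
    rintro (_ | i) hi φ hφ
    · rw [hB0]
      refine ⟨fun h => (Submodule.mem_bot ℂ).2 (h0 hi φ hφ h), fun h => ?_⟩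
      rw [(Submodule.mem_bot ℂ).1 h, map_zero]
    · rw [hBs]
      refine ⟨fun h => ?_, ?_⟩
      · obtain ⟨ψ, hψ, h⟩ := hex i hi φ hφ h
        exact ⟨ψ, hψ, h⟩
      · rintro ⟨ψ, hψ, rfl⟩
        exact hδδ i ψ hψ
  have hstep : ∀ i < k, ∀ g, (ρ.subrepresentation (C i) (hC i)).character g =
      (ρ.subrepresentation (B i) (hB i)).character g +
        (ρ.subrepresentation (B (i + 1)) (hB (i + 1))).character g := by
    intro i hi g
    refine trace_add_trace_of_exact (ι := Submodule.inclusion (hBC i))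
      (π := δ.restrict (p := C i) (q := B (i + 1)) fun φ hφ => hBs i ▸ ⟨φ, hφ, rfl⟩)
      (Submodule.inclusion_injective _) ?_ ?_ ?_ ?_
    · rintro ⟨ψ, hψ⟩
      obtain ⟨φ, hφ, rfl⟩ := hBs i ▸ hψ
      exact ⟨⟨φ, hφ⟩, rfl⟩
    · rintro ⟨φ, hφ⟩
      rw [Subtype.ext_iff]
      refine (hker i hi φ hφ).trans ⟨fun h => ⟨⟨φ, h⟩, rfl⟩, ?_⟩
      rintro ⟨⟨ψ, hψ⟩, h⟩
      have : ψ = φ := congrArg Subtype.val h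
      exact this ▸ hψ
    · ext φ
      rfl
    · ext φ
      exact hδ g φ
  have hsum : ∀ j ≤ k, ∀ g, (ρ.subrepresentation (B j) (hB j)).character g =
      -∑ i ∈ Finset.range j, (-1) ^ (j - i) * (ρ.subrepresentation (C i) (hC i)).character g := by
    intro j
    induction j with
    | zero =>
      intro _ g
      have : ρ.subrepresentation (B 0) (hB 0) g = 0 := by
        ext φ
        exact (Submodule.mem_bot ℂ).1 (hB0 ▸ (ρ.subrepresentation (B 0) (hB 0) g φ).2)
      rw [Representation.character, this]
      simp
    | succ j ih =>
      intro hj g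
      have h1 := hstep j hj g
      rw [ih (by omega) g] at h1
      have h2 : ∑ i ∈ Finset.range j, (-1) ^ (j + 1 - i) *
          (ρ.subrepresentation (C i) (hC i)).character g = -∑ i ∈ Finset.range j, (-1) ^ (j - i) *
          (ρ.subrepresentation (C i) (hC i)).character g := by
        rw [← Finset.sum_neg_distrib]
        refine Finset.sum_congr rfl fun i hi => ?_
        rw [Nat.sub_add_comm (Finset.mem_range.1 hi).le, pow_succ]
        ring
      rw [Finset.sum_range_succ, Nat.add_sub_cancel_left, pow_one, h2, h1]
      ring
  let P : Submodule ℂ (C k) := (B k).comap (C k).subtype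
  have hP : ∀ g, P ≤ P.comap (ρ.subrepresentation (C k) (hC k) g) := fun g φ hφ => hB k g hφ
  have htop : ∀ g, (ρ.subrepresentation (C k) (hC k)).character g =
      (ρ.subrepresentation (B k) (hB k)).character g +
        ((ρ.subrepresentation (C k) (hC k)).quotient P hP).character g := by
    intro g
    refine trace_add_trace_of_exact (ι := Submodule.inclusion (hBC k)) (π := P.mkQ)
      (Submodule.inclusion_injective _) P.mkQ_surjective ?_ ?_ ?_
    · rintro ⟨φ, hφ⟩
      rw [Submodule.mkQ_apply, Submodule.Quotient.mk_eq_zero]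
      refine ⟨fun h => ⟨⟨φ, h⟩, rfl⟩, ?_⟩
      rintro ⟨⟨ψ, hψ⟩, h⟩
      have : ψ = φ := congrArg Subtype.val h
      subst this
      exact hψ
    · ext φ
      rfl
    · ext φ
      rfl
  have heq : (fun g => ∑ i ∈ Finset.range (k + 1),
      (-1) ^ (k - i) * (ρ.subrepresentation (C i) (hC i)).character g) =
      ((ρ.subrepresentation (C k) (hC k)).quotient P hP).character := by
    funext g
    have h1 := htop g
    rw [hsum k le_rfl g] at h1
    rw [Finset.sum_range_succ, Nat.sub_self, pow_zero, one_mul, h1]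
    ring
  rw [heq]
  exact Representation.isEffectiveCharacter _

theorem trace_pi {Y : Type*} [Fintype Y] [DecidableEq Y] (f : (Y → ℂ) →ₗ[ℂ] (Y → ℂ)) :
    trace ℂ (Y → ℂ) f = ∑ y, f (Pi.single y 1) y := by
  simp [trace_eq_matrix_trace ℂ (Pi.basisFun ℂ Y), Matrix.trace]

/-- The representation of `G` on the functions on a `G`-set. -/
def functionRep (G Y : Type*) [Group G] [MulAction G Y] : Representation ℂ G (Y → ℂ) where
  toFun g := LinearMap.funLeft ℂ ℂ fun y => g⁻¹ • y
  map_one' := by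
    ext φ y
    simp [LinearMap.funLeft_apply]
  map_mul' g h := by
    ext φ y
    simp [LinearMap.funLeft_apply, mul_smul]

theorem functionRep_apply {G Y : Type*} [Group G] [MulAction G Y] (g : G) (φ : Y → ℂ) (y : Y) :
    functionRep G Y g φ y = φ (g⁻¹ • y) := rfl

open Classical in
/-- The character of the representation on the functions supported on an invariant set counts
fixed points. -/
theorem character_subrepresentation_functionRep {G Y : Type*} [Group G] [MulAction G Y]
    [Fintype Y] (C : Submodule ℂ (Y → ℂ)) (hC : ∀ g, C ≤ C.comap (functionRep G Y g))
    (P : Y → Prop) (hP : ∀ φ, φ ∈ C ↔ ∀ y, φ y ≠ 0 → P y) (g : G) :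
    ((functionRep G Y).subrepresentation C hC).character g =
      ((Finset.univ.filter fun y => P y ∧ g • y = y).card : ℂ) := by
  -- Projecting onto the functions supported on `P` reduces the trace on `C` to a trace on `Y → ℂ`,
  -- read off from the standard basis.
  let q : (Y → ℂ) →ₗ[ℂ] C :=
    { toFun := fun φ => ⟨fun y => if P y then φ y else 0, (hP _).2 fun y hy => by
        by_contra h
        simp [h] at hy⟩
      map_add' := fun φ ψ => by
        ext y
        by_cases h : P y <;> simp [h]
      map_smul' := fun a φ => by
        ext y
        by_cases h : P y <;> simp [h] }
  have hq : q ∘ₗ C.subtype = LinearMap.id := by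
    ext ⟨φ, hφ⟩ y
    by_cases h : P y
    · simp [q, h]
    · have : φ y = 0 := by
        by_contra h0
        exact h ((hP φ).1 hφ y h0)
      simp [q, h, this]
  have h1 : (functionRep G Y).subrepresentation C hC g =
      q ∘ₗ (functionRep G Y g ∘ₗ C.subtype) := by
    have : functionRep G Y g ∘ₗ C.subtype =
        C.subtype ∘ₗ (functionRep G Y).subrepresentation C hC g := by
      ext φ
      rfl
    rw [this, ← LinearMap.comp_assoc, hq, LinearMap.id_comp]
  rw [Representation.character, h1, trace_comp_comm', LinearMap.comp_assoc, trace_pi,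
    Finset.card_filter, Nat.cast_sum]
  refine Finset.sum_congr rfl fun y _ => ?_
  have h2 : (functionRep G Y g ∘ₗ C.subtype ∘ₗ q) (Pi.single y 1) y =
      if P (g⁻¹ • y) then (Pi.single y 1 : Y → ℂ) (g⁻¹ • y) else 0 := rfl
  rw [h2]
  by_cases hy : g • y = y
  · have hy' : g⁻¹ • y = y := by rw [inv_smul_eq_iff, hy]
    by_cases h : P y <;> simp [hy, hy', h]
  · have hy' : g⁻¹ • y ≠ y := by
      rw [Ne, inv_smul_eq_iff]
      exact fun h => hy h.symm
    simp [hy, hy']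

end Characters

/-! ### Group actions on colored complexes -/

namespace ColoredComplex

open scoped Pointwise

variable {G V : Type*} [Group G] [MulAction G V] [DecidableEq V] {κ : V → ℕ}

/-- Orienting faces by an invariant coloring makes the action free of signs, so a plain permutation
representation commutes with the coboundary. -/
theorem incidence_smul (hκ : ∀ (g : G) v, κ (g • v) = κ v) (g : G) (F : Finset V) (I : V) :
    incidence κ (g • F) (g • I) = incidence κ F I := by
  classical
  unfold incidence
  congr 1
  have : (g • F).filter (fun J => κ J < κ (g • I)) = g • F.filter fun J => κ J < κ I := by
    ext J
    simp only [Finset.mem_filter, Finset.mem_smul_finset]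
    constructor
    · rintro ⟨⟨K, hK, rfl⟩, h⟩
      exact ⟨K, ⟨hK, by simpa [hκ] using h⟩, rfl⟩
    · rintro ⟨K, ⟨hK, h⟩, rfl⟩
      exact ⟨⟨K, hK, rfl⟩, by simpa [hκ] using h⟩
  rw [this, Finset.card_smul_finset]

theorem smul_erase (g : G) (F : Finset V) (I : V) : g • F.erase I = (g • F).erase (g • I) :=
  Finset.image_erase (MulAction.injective g) F I

theorem coboundary_functionRep {X : Set (Finset V)} (hX : ∀ (g : G), ∀ F ∈ X, g • F ∈ X)
    (hκ : ∀ (g : G) v, κ (g • v) = κ v) (g : G) (φ : Finset V → ℂ) :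
    coboundary κ X (functionRep G (Finset V) g φ) =
      functionRep G (Finset V) g (coboundary κ X φ) := by
  funext F
  rw [functionRep_apply]
  by_cases hF : F ∈ X
  · rw [coboundary_apply_of_mem _ hF, coboundary_apply_of_mem _ (hX g⁻¹ F hF),
      Finset.smul_finset_def, Finset.sum_image (MulAction.injective _).injOn]
    refine Finset.sum_congr rfl fun I hI => ?_
    rw [functionRep_apply, smul_erase, ← incidence_smul hκ g⁻¹ F I]
    rfl
  · rw [coboundary_apply_of_notMem _ hF, coboundary_apply_of_notMem]
    intro h
    exact hF (by simpa using hX g _ h)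

open Classical in
/-- If the cohomology of an invariant complex vanishes below the top degree `k`, the alternating
sum of the numbers of fixed faces is an effective character. -/
theorem isEffectiveCharacter_of_acyclicAt [Fintype V] {X : Set (Finset V)} (hX : X.OrdConnected)
    (hXκ : ∀ F ∈ X, Set.InjOn κ F) (hXG : ∀ (g : G), ∀ F ∈ X, g • F ∈ X)
    (hκ : ∀ (g : G) v, κ (g • v) = κ v) (k : ℕ) (hac : ∀ i < k, AcyclicAt κ X i) :
    IsEffectiveCharacter fun g : G => ∑ i ∈ Finset.range (k + 1), (-1) ^ (k - i) *
      ((Finset.univ.filter fun F : Finset V => (F ∈ X ∧ F.card = i) ∧ g • F = F).card : ℂ) := by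
  have hC : ∀ i (g : G),
      cochains X i ≤ (cochains X i).comap (functionRep G (Finset V) g) := by
    intro i g φ hφ F hF
    have := hφ (g⁻¹ • F) hF
    rw [Finset.card_smul_finset] at this
    exact ⟨by simpa using hXG g _ this.1, this.2⟩
  have heff := isEffectiveCharacter_of_exact (functionRep G (Finset V)) (cochains X) hC
    (coboundary κ X) (coboundary_functionRep hXG hκ)
    (fun i φ hφ => coboundary_mem_cochains fun F h => by rw [(hφ F h).2])
    (fun i φ hφ => coboundary_coboundary hX hXκ fun F h => (hφ F h).1) k ?_ ?_
  · convert heff using 5 with g i hi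
    refine Eq.trans ?_ (character_subrepresentation_functionRep (cochains X i) (hC i)
      (fun F => F ∈ X ∧ F.card = i) (fun φ => Iff.rfl) g).symm
    congr!
  · intro hk φ hφ hδ
    obtain ⟨ψ, hψ, rfl⟩ := hac 0 hk φ hφ hδ
    have : ψ = 0 := by
      funext F
      by_contra h0
      exact absurd (hψ F h0).2 (by omega)
    rw [this, map_zero]
  · intro i hi φ hφ hδ
    obtain ⟨ψ, hψ, h⟩ := hac (i + 1) hi φ hφ hδ
    exact ⟨ψ, fun F h0 => ⟨(hψ F h0).1, Nat.succ_injective (hψ F h0).2⟩, h⟩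

end ColoredComplex

/-! ### Möbius inversion over finite sets -/

section Moebius

theorem neg_one_pow_card_sub {α : Type*} {T S : Finset α} (h : T ⊆ S) :
    (-1 : ℂ) ^ (S.card - T.card) = (-1) ^ S.card * (-1) ^ T.card := by
  have hle := Finset.card_le_card h
  obtain ⟨k, hk⟩ := Nat.exists_eq_add_of_le hle
  rw [hk, Nat.add_sub_cancel_left, pow_add, mul_right_comm, ← pow_add, Even.neg_one_pow ⟨_, rfl⟩,
    one_mul]

variable {α : Type*} [DecidableEq α]

theorem sum_Icc_neg_one_pow_card {U S : Finset α} (h : U ⊆ S) :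
    ∑ T ∈ Finset.Icc U S, (-1 : ℂ) ^ T.card = if U = S then (-1) ^ S.card else 0 := by
  have hinj : Set.InjOn (fun R => U ∪ R) ((S \ U).powerset : Set (Finset α)) := by
    intro R hR R' hR' hRR'
    have hd : ∀ R ∈ ((S \ U).powerset : Set (Finset α)), (U ∪ R) \ U = R := fun R hR => by
      rw [Finset.union_sdiff_cancel_left]
      exact Finset.disjoint_sdiff.mono_right (Finset.mem_powerset.1 hR)
    rw [← hd R hR, ← hd R' hR']
    exact congrArg (· \ U) hRR'
  have hcard : ∀ R ∈ (S \ U).powerset,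
      (-1 : ℂ) ^ (U ∪ R).card = (-1) ^ U.card * (((-1 : ℤ) ^ R.card : ℤ) : ℂ) := fun R hR => by
    rw [Finset.card_union_of_disjoint
      (Finset.disjoint_sdiff.mono_right (Finset.mem_powerset.1 hR)), pow_add]
    simp
  rw [Finset.Icc_eq_image_powerset h, Finset.sum_image hinj, Finset.sum_congr rfl hcard,
    ← Finset.mul_sum, ← Int.cast_sum, Finset.sum_powerset_neg_one_pow_card]
  by_cases hUS : U = S
  · simp [hUS]
  · have : ¬ S \ U = ∅ := fun h' => hUS (h.antisymm (Finset.sdiff_eq_empty_iff_subset.1 h'))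
    simp [hUS, this]

/-- Möbius inversion on the Boolean lattice, as an equivalence so that it yields both existence and
uniqueness of the fundamental coefficients. -/
theorem sum_powerset_eq_iff (c a : Finset α → ℂ) :
    (∀ T, ∑ S ∈ T.powerset, c S = a T) ↔
      ∀ S, c S = ∑ T ∈ S.powerset, (-1) ^ (S.card - T.card) * a T := by
  have hswap : ∀ (S : Finset α) (f : Finset α → Finset α → ℂ),
      ∑ T ∈ S.powerset, ∑ U ∈ T.powerset, f T U =
        ∑ U ∈ S.powerset, ∑ T ∈ Finset.Icc U S, f T U := by
    intro S f
    refine Finset.sum_comm' fun T U => ?_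
    simp only [Finset.mem_powerset, Finset.mem_Icc]
    exact ⟨fun h => ⟨⟨h.2, h.1⟩, h.2.trans h.1⟩, fun h => ⟨h.1.2, h.1.1⟩⟩
  have hsq : ∀ S : Finset α, (-1 : ℂ) ^ S.card * (-1) ^ S.card = 1 := fun S => by
    rw [← pow_add, Even.neg_one_pow ⟨_, rfl⟩]
  constructor
  · intro h S
    have h1 : ∑ T ∈ S.powerset, (-1) ^ (S.card - T.card) * a T =
        ∑ T ∈ S.powerset, ∑ U ∈ T.powerset, (-1) ^ S.card * (-1) ^ T.card * c U := by
      refine Finset.sum_congr rfl fun T hT => ?_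
      rw [neg_one_pow_card_sub (Finset.mem_powerset.1 hT), ← h T, Finset.mul_sum]
    rw [h1, hswap, Finset.sum_eq_single S]
    · simp [hsq]
    · intro U hU hne
      rw [← Finset.sum_mul, ← Finset.mul_sum, sum_Icc_neg_one_pow_card (Finset.mem_powerset.1 hU),
        if_neg hne]
      ring
    · exact fun h => absurd (Finset.mem_powerset_self S) h
  · intro h T
    have h1 : ∑ S ∈ T.powerset, c S =
        ∑ S ∈ T.powerset, ∑ U ∈ S.powerset, (-1) ^ S.card * ((-1) ^ U.card * a U) := by
      refine Finset.sum_congr rfl fun S _ => ?_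
      rw [h S]
      refine Finset.sum_congr rfl fun U hU => ?_
      rw [neg_one_pow_card_sub (Finset.mem_powerset.1 hU)]
      ring
    rw [h1, hswap, Finset.sum_eq_single T]
    · rw [Finset.Icc_self, Finset.sum_singleton, ← mul_assoc, hsq, one_mul]
    · intro U hU hne
      rw [← Finset.sum_mul, sum_Icc_neg_one_pow_card (Finset.mem_powerset.1 hU), if_neg hne]
      ring
    · exact fun h => absurd (Finset.mem_powerset_self T) h

end Moebius

/-! ### Coefficients of quasisymmetric functions -/

section Coefficients

/-- The exponent of `x_0 ⋯ x_{m-1}` in the monomial `d`. -/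
def prefixSum (d : ℕ →₀ ℕ) (m : ℕ) : ℕ := ∑ l ∈ Finset.range m, d l

theorem prefixSum_succ (d : ℕ →₀ ℕ) (m : ℕ) : prefixSum d (m + 1) = prefixSum d m + d m :=
  Finset.sum_range_succ _ _

theorem prefixSum_mono (d : ℕ →₀ ℕ) : Monotone (prefixSum d) :=
  monotone_nat_of_le_succ fun m => by
    rw [prefixSum_succ]
    omega

theorem prefixSum_le_degree (d : ℕ →₀ ℕ) (m : ℕ) : prefixSum d m ≤ d.degree := by
  classical
  rw [Finsupp.degree_apply, prefixSum, ← Finset.sum_subset (Finset.inter_subset_left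
    (s₂ := d.support))]
  · exact Finset.sum_le_sum_of_subset Finset.inter_subset_right
  · intro l hl hl'
    by_contra h
    exact hl' (Finset.mem_inter.2 ⟨hl, Finsupp.mem_support_iff.2 h⟩)

theorem exists_prefixSum_eq_degree (d : ℕ →₀ ℕ) : ∃ m, prefixSum d m = d.degree := by
  obtain ⟨m, hm⟩ := d.support.exists_nat_subset_range
  exact ⟨m, (Finset.sum_subset hm fun l _ hl => Finsupp.notMem_support_iff.1 hl).symm⟩

open Classical in
/-- The subset of `[n-1]` given by the proper partial sums of the exponents of `d`; as in
`subsetComposition`, the element `s : Fin (n - 1)` stands for `s + 1 ∈ [n-1]`. -/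
noncomputable def prefixSet (n : ℕ) (d : ℕ →₀ ℕ) : Finset (Fin (n - 1)) :=
  Finset.univ.filter fun s => ∃ m, prefixSum d m = s + 1

theorem mem_prefixSet {n : ℕ} {d : ℕ →₀ ℕ} {s : Fin (n - 1)} :
    s ∈ prefixSet n d ↔ ∃ m, prefixSum d m = s + 1 := by
  simp [prefixSet]

variable {n : ℕ} (T : Finset (Fin (n - 1)))

theorem exists_sizeUpTo_iff {x : ℕ} :
    (∃ j ≤ (subsetComposition n T).length, (subsetComposition n T).sizeUpTo j = x) ↔
      x = 0 ∨ x = n ∨ ∃ s ∈ T, x = s + 1 := by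
  have hb : ∀ y : Fin (n + 1), y ∈ (subsetComposition n T).boundaries ↔
      y = 0 ∨ y = Fin.last n ∨ ∃ s ∈ T, (y : ℕ) = s + 1 := by
    intro y
    rw [subsetComposition, CompositionAsSet.toComposition_boundaries]
    simp [compositionAsSetEquiv]
  have hb' : ∀ y : Fin (n + 1), y ∈ (subsetComposition n T).boundaries ↔
      ∃ j ≤ (subsetComposition n T).length, (subsetComposition n T).sizeUpTo j = y := by
    intro y
    simp only [Composition.boundaries, Finset.mem_map, Finset.mem_univ, true_and]
    constructor
    · rintro ⟨j, rfl⟩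
      exact ⟨j, Nat.lt_succ_iff.1 j.2, rfl⟩
    · rintro ⟨j, hj, h⟩
      exact ⟨⟨j, Nat.lt_succ_iff.2 hj⟩, Fin.ext h⟩
  by_cases hx : x < n + 1
  · have := (hb' ⟨x, hx⟩).symm.trans (hb ⟨x, hx⟩)
    simpa [Fin.ext_iff] using this
  · constructor
    · rintro ⟨j, _, rfl⟩
      exact absurd (Nat.lt_succ_of_le ((subsetComposition n T).sizeUpTo_le j)) hx
    · rintro (rfl | rfl | ⟨s, _, rfl⟩) <;> omega

theorem sizeUpTo_eq_sum (c : Composition n) (k : ℕ) :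
    c.sizeUpTo k = ∑ j ∈ Finset.univ.filter (fun j : Fin c.length => j.1 < k), c.blocksFun j := by
  induction k with
  | zero => simp
  | succ k ih =>
    by_cases hk : k < c.length
    · have : (Finset.univ.filter fun j : Fin c.length => (j : ℕ) < k + 1) =
          insert ⟨k, hk⟩ (Finset.univ.filter fun j : Fin c.length => (j : ℕ) < k) := by
        ext j
        simp only [Finset.mem_filter, Finset.mem_univ, true_and, Finset.mem_insert, Fin.ext_iff]
        omega
      rw [this, Finset.sum_insert (by simp), ← ih, c.sizeUpTo_succ hk, add_comm]
      rfl
    · rw [c.sizeUpTo_ofLength_le (k + 1) (by omega)]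
      rw [c.sizeUpTo_ofLength_le k (by omega)] at ih
      refine ih.trans ?_
      refine Finset.sum_congr (Finset.filter_congr fun j _ => ?_) fun _ _ => rfl
      have := j.2
      omega

/-- The sequences counted by a coefficient of `monomialQSym`. -/
def IsMonomialSeq (d : ℕ →₀ ℕ) (i : Fin (subsetComposition n T).length → ℕ) : Prop :=
  StrictMono i ∧ ∑ j, Finsupp.single (i j) ((subsetComposition n T).blocksFun j) = d

/-! ### Recovering the subset and the sequence from a monomial -/

namespace IsMonomialSeq

variable {T} {d : ℕ →₀ ℕ} {i i' : Fin (subsetComposition n T).length → ℕ}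

theorem apply_eq (h : IsMonomialSeq T d i) (j : Fin (subsetComposition n T).length) :
    d (i j) = (subsetComposition n T).blocksFun j := by
  rw [← h.2, Finsupp.finsetSum_apply, Finset.sum_eq_single j]
  · simp
  · intro k _ hk
    exact Finsupp.single_eq_of_ne fun e => hk (h.1.injective e.symm)
  · simp

theorem degree_eq (h : IsMonomialSeq T d i) : d.degree = n := by
  rw [← h.2, map_sum]
  simp only [Finsupp.degree_single]
  exact (subsetComposition n T).sum_blocksFun

theorem prefixSum_eq (h : IsMonomialSeq T d i) (m : ℕ) :
    prefixSum d m = ∑ j with i j < m, (subsetComposition n T).blocksFun j := by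
  rw [prefixSum, ← h.2, Finset.sum_filter]
  simp only [Finsupp.finsetSum_apply]
  rw [Finset.sum_comm]
  refine Finset.sum_congr rfl fun j _ => ?_
  simp [Finsupp.single_apply]

theorem prefixSum_apply (h : IsMonomialSeq T d i) (j : Fin (subsetComposition n T).length) :
    prefixSum d (i j) = (subsetComposition n T).sizeUpTo j := by
  rw [h.prefixSum_eq, sizeUpTo_eq_sum]
  refine Finset.sum_congr (Finset.filter_congr fun k _ => ?_) fun _ _ => rfl
  rw [h.1.lt_iff_lt]
  rfl

theorem exists_sizeUpTo_eq (h : IsMonomialSeq T d i) (m : ℕ) :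
    ∃ j ≤ (subsetComposition n T).length,
      (subsetComposition n T).sizeUpTo j = prefixSum d m := by
  by_cases hm : ∃ j, m ≤ i j
  · have hne : (Finset.univ.filter fun j => m ≤ i j).Nonempty := by
      obtain ⟨j, hj⟩ := hm
      exact ⟨j, by simpa using hj⟩
    obtain ⟨j, hj, hmin⟩ := Finset.exists_min_image _ (fun j => j.1) hne
    refine ⟨j, j.2.le, ?_⟩
    rw [h.prefixSum_eq, sizeUpTo_eq_sum]
    refine Finset.sum_congr (Finset.filter_congr fun k _ => ?_) fun _ _ => rfl
    simp only [Finset.mem_filter, Finset.mem_univ, true_and] at hj hmin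
    constructor
    · intro hk
      by_contra hcon
      exact absurd (hmin k (by omega)) (by omega)
    · intro hk
      by_contra hcon
      have : i j ≤ i k := h.1.monotone (by rw [Fin.le_def]; omega)
      omega
  · push Not at hm
    refine ⟨_, le_rfl, ?_⟩
    rw [h.prefixSum_eq, sizeUpTo_eq_sum]
    refine Finset.sum_congr (Finset.filter_congr fun k _ => ?_) fun _ _ => rfl
    simp [hm k]

/-- Vanishing exponents only repeat partial sums, so the partial sums of `d` are exactly those of
the composition. -/
theorem prefixSet_eq (h : IsMonomialSeq T d i) : prefixSet n d = T := by
  ext s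
  have hs := s.2
  rw [mem_prefixSet]
  have key : (∃ m, prefixSum d m = s + 1) ↔
      ∃ j ≤ (subsetComposition n T).length, (subsetComposition n T).sizeUpTo j = s + 1 := by
    constructor
    · rintro ⟨m, hm⟩
      rw [← hm]
      exact h.exists_sizeUpTo_eq m
    · rintro ⟨j, hj, hjs⟩
      rcases hj.lt_or_eq with hj | rfl
      · exact ⟨i ⟨j, hj⟩, (h.prefixSum_apply ⟨j, hj⟩).trans hjs⟩
      · rw [Composition.sizeUpTo_length] at hjs
        omega
  rw [key, exists_sizeUpTo_iff]
  constructor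
  · rintro (h0 | h0 | ⟨s', hs', h0⟩)
    · omega
    · omega
    · rwa [Fin.ext (by omega : (s : ℕ) = s')]
  · exact fun h => Or.inr (Or.inr ⟨s, h, rfl⟩)

/-- If `i j` came before `i' j`, the sum of the exponents before `i' j` would include the positive
one at `i j`, exceeding `sizeUpTo j`. -/
theorem le (h : IsMonomialSeq T d i) (h' : IsMonomialSeq T d i')
    (j : Fin (subsetComposition n T).length) : i' j ≤ i j := by
  by_contra hlt
  have h1 := prefixSum_mono d (not_le.1 hlt)
  rw [Nat.succ_eq_add_one, prefixSum_succ, h.prefixSum_apply, h'.prefixSum_apply, h.apply_eq] at h1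
  have := (subsetComposition n T).one_le_blocksFun j
  omega

theorem unique (h : IsMonomialSeq T d i) (h' : IsMonomialSeq T d i') : i = i' :=
  funext fun j => le_antisymm (h'.le h j) (h.le h' j)

end IsMonomialSeq

/-- The index `i j` is the one whose exponent first pushes the partial sums of `d` above `sizeUpTo
j`. -/
theorem exists_isMonomialSeq {d : ℕ →₀ ℕ} (hd : d.degree = n) (hT : prefixSet n d = T) :
    ∃ i, IsMonomialSeq T d i := by
  set c := subsetComposition n T with hc
  obtain ⟨M, hM⟩ := exists_prefixSum_eq_degree d
  have hsize : ∀ j ≤ c.length, ∃ m, prefixSum d m = c.sizeUpTo j := by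
    intro j hj
    rcases (exists_sizeUpTo_iff T).1 ⟨j, hj, rfl⟩ with h | h | ⟨s, hs, h⟩
    · exact ⟨0, by rw [hc, h]; rfl⟩
    · exact ⟨M, by rw [hc, h, hM, hd]⟩
    · rw [← hT, mem_prefixSet] at hs
      rw [hc, h]
      exact hs
  have hpre : ∀ m, ∃ j ≤ c.length, c.sizeUpTo j = prefixSum d m := by
    intro m
    refine (exists_sizeUpTo_iff T).2 ?_
    have hle := prefixSum_le_degree d m
    by_cases h0 : prefixSum d m = 0
    · exact Or.inl h0
    by_cases h1 : prefixSum d m = n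
    · exact Or.inr (Or.inl h1)
    refine Or.inr (Or.inr ⟨⟨prefixSum d m - 1, by omega⟩, ?_, ?_⟩)
    · rw [← hT, mem_prefixSet]
      exact ⟨m, by simp only; omega⟩
    · simp only
      omega
  have hlt : ∀ j : Fin c.length, c.sizeUpTo j < c.sizeUpTo (j + 1) :=
    fun j => c.sizeUpTo_strict_mono j.2
  have hex : ∀ j : Fin c.length, ∃ m, c.sizeUpTo j < prefixSum d (m + 1) := by
    intro j
    refine ⟨M, ?_⟩
    have h1 := prefixSum_mono d (Nat.le_succ M)
    have h2 := c.sizeUpTo_le (j + 1)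
    have h3 := hlt j
    rw [Nat.succ_eq_add_one] at h1
    omega
  let i : Fin c.length → ℕ := fun j => Nat.find (hex j)
  have hi1 : ∀ j : Fin c.length, c.sizeUpTo j < prefixSum d (i j + 1) := fun j => Nat.find_spec (hex j)
  have hi2 : ∀ j : Fin c.length, prefixSum d (i j) ≤ c.sizeUpTo j := by
    intro j
    rcases hij : i j with _ | m
    · exact Nat.zero_le _
    · exact not_lt.1 (Nat.find_min (hex j) (by change m < i j; omega))
  have hi3 : ∀ j : Fin c.length, prefixSum d (i j) = c.sizeUpTo j := by
    intro j
    obtain ⟨m, hm⟩ := hsize j j.2.le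
    refine le_antisymm (hi2 j) ?_
    rw [← hm]
    refine prefixSum_mono d ?_
    by_contra hcon
    have h1 := prefixSum_mono d (not_le.1 hcon)
    have h2 := hi1 j
    rw [Nat.succ_eq_add_one] at h1
    omega
  have hi4 : ∀ j : Fin c.length, prefixSum d (i j + 1) = c.sizeUpTo (j + 1) := by
    intro j
    apply le_antisymm
    · obtain ⟨m, hm⟩ := hsize (j + 1) j.2
      rw [← hm]
      refine prefixSum_mono d ?_
      by_contra hcon
      have h1 := prefixSum_mono d (by omega : m ≤ i j)
      have h2 := hlt j
      have h3 := hi3 j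
      omega
    · obtain ⟨k, hk, hkm⟩ := hpre (i j + 1)
      rw [← hkm]
      refine c.monotone_sizeUpTo ?_
      by_contra hcon
      have h1 := c.monotone_sizeUpTo (by omega : k ≤ j)
      have h2 := hi1 j
      omega
  have happ : ∀ j, d (i j) = c.blocksFun j := by
    intro j
    have h1 := prefixSum_succ d (i j)
    have h2 := c.sizeUpTo_succ' j
    have h3 := hi3 j
    have h4 := hi4 j
    omega
  have hmono : StrictMono i := by
    intro j k hjk
    by_contra hcon
    have h1 := prefixSum_mono d (not_lt.1 hcon)
    rw [hi3, hi3] at h1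
    have h2 := hlt j
    have h3 := c.monotone_sizeUpTo (by rw [Fin.lt_def] at hjk; omega : (j : ℕ) + 1 ≤ k)
    omega
  refine ⟨i, hmono, ?_⟩
  have hseq : IsMonomialSeq T (∑ j, Finsupp.single (i j) (c.blocksFun j)) i := ⟨hmono, rfl⟩
  -- It suffices to compare coefficientwise, since both sides have degree `n`.
  have hle : ∑ j, Finsupp.single (i j) (c.blocksFun j) ≤ d := by
    intro l
    by_cases hl : ∃ j, i j = l
    · obtain ⟨j, rfl⟩ := hl
      rw [hseq.apply_eq, happ]
    · push Not at hl
      rw [Finsupp.finsetSum_apply, Finset.sum_eq_zero fun j _ =>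
        Finsupp.single_eq_of_ne (hl j).symm]
      exact Nat.zero_le _
  obtain ⟨e, he⟩ := exists_add_of_le hle
  have hdeg := congrArg Finsupp.degree he
  rw [map_add, hseq.degree_eq, hd] at hdeg
  have he0 : e = 0 := (Finsupp.degree_eq_zero_iff e).1 (by omega)
  rw [he, he0, add_zero]

open Classical in
theorem monomialQSym_apply (d : ℕ →₀ ℕ) :
    monomialQSym n T d = if d.degree = n ∧ prefixSet n d = T then 1 else 0 := by
  change ((Nat.card {i // IsMonomialSeq T d i} : ℕ) : ℂ) = _
  split_ifs with h
  · obtain ⟨i, hi⟩ := exists_isMonomialSeq T h.1 h.2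
    have : Nat.card {i // IsMonomialSeq T d i} = 1 :=
      Nat.card_eq_one_iff_unique.2
        ⟨⟨fun a b => Subtype.ext (a.2.unique b.2)⟩, ⟨⟨i, hi⟩⟩⟩
    rw [this, Nat.cast_one]
  · have : IsEmpty {i // IsMonomialSeq T d i} :=
      ⟨fun i => h ⟨i.2.degree_eq, i.2.prefixSet_eq⟩⟩
    rw [Nat.card_of_isEmpty, Nat.cast_zero]

theorem exists_prefixSet_eq : ∃ d : ℕ →₀ ℕ, d.degree = n ∧ prefixSet n d = T := by
  have h : IsMonomialSeq T _ (fun j => (j : ℕ)) := ⟨fun _ _ h => h, rfl⟩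
  exact ⟨_, h.degree_eq, h.prefixSet_eq⟩

/-- If the coefficients of `Φ` in the monomial basis are `a`, its coefficients in the fundamental
basis are given by Möbius inversion. -/
theorem isFundamentalExpansion_iff {G : Type*} {Φ : G → MvPowerSeries ℕ ℂ}
    {a : Finset (Fin (n - 1)) → G → ℂ}
    (hΦ : ∀ g (d : ℕ →₀ ℕ), Φ g d = if d.degree = n then a (prefixSet n d) g else 0)
    (c : Finset (Fin (n - 1)) → G → ℂ) :
    IsFundamentalExpansion n Φ c ↔
      ∀ S g, c S g = ∑ T ∈ S.powerset, (-1) ^ (S.card - T.card) * a T g := by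
  classical
  have hF : ∀ S (d : ℕ →₀ ℕ), fundamentalQSym n S d =
      if d.degree = n ∧ S ⊆ prefixSet n d then 1 else 0 := by
    intro S d
    have h1 : fundamentalQSym n S d = ∑ T with S ⊆ T, monomialQSym n T d := by
      rw [fundamentalQSym]
      exact Finset.sum_apply d _ _
    simp only [h1, monomialQSym_apply]
    by_cases hd : d.degree = n <;> simp [hd]
  have hsum : ∀ g (d : ℕ →₀ ℕ), (∑ S, c S g • fundamentalQSym n S) d =
      if d.degree = n then ∑ S ∈ (prefixSet n d).powerset, c S g else 0 := by
    intro g d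
    have h1 : (∑ S, c S g • fundamentalQSym n S) d = ∑ S, c S g * fundamentalQSym n S d :=
      Finset.sum_apply d _ _
    rw [h1]
    simp only [hF]
    by_cases hd : d.degree = n
    · simp only [hd, true_and, mul_ite, mul_one, mul_zero, if_true]
      rw [← Finset.sum_filter]
      refine Finset.sum_congr ?_ fun _ _ => rfl
      ext S
      simp
    · simp [hd]
  have key : IsFundamentalExpansion n Φ c ↔ ∀ g T, ∑ S ∈ T.powerset, c S g = a T g := by
    constructor
    · intro h g T
      obtain ⟨d, hd, rfl⟩ := exists_prefixSet_eq T
      have h1 := congrFun (h g) d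
      rw [hΦ, hsum, if_pos hd, if_pos hd] at h1
      exact h1.symm
    · intro h g
      funext d
      rw [hΦ, hsum, h]
  rw [key, forall_comm (α := Finset (Fin (n - 1)))]
  exact forall_congr' fun g => sum_powerset_eq_iff (fun S => c S g) fun T => a T g

end Coefficients

/-! ### Functions and chains of initial segments -/

section InitialSegments

open scoped Pointwise

theorem smul_mem_faces {N : Type*} [DecidableEq N] {G : Type*} [Group G] [MulAction G N]
    {r : N → N → Prop} {W : Finset (N × N)} {S : Finset ℕ}
    (hr : ∀ (g : G) u v, r u v → r (g • u) (g • v))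
    (hW : ∀ (g : G), ∀ p ∈ W, (g • p.1, g • p.2) ∈ W) (g : G) {F : Finset (Finset N)}
    (hF : F ∈ faces r W S) : g • F ∈ faces r W S := by
  refine ⟨?_, fun I' hI' => ?_, fun p hp => ?_⟩
  · intro I' hI' J' hJ' _
    obtain ⟨I, hI, rfl⟩ := Finset.mem_smul_finset.1 hI'
    obtain ⟨J, hJ, rfl⟩ := Finset.mem_smul_finset.1 hJ'
    exact (hF.1.total hI hJ).imp Finset.smul_finset_subset_smul_finset
      Finset.smul_finset_subset_smul_finset
  · obtain ⟨I, hI, rfl⟩ := Finset.mem_smul_finset.1 hI'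
    refine ⟨by simpa using (hF.2.1 I hI).1, fun u v huv hv => ?_⟩
    rw [← Finset.inv_smul_mem_iff] at hv ⊢
    exact (hF.2.1 I hI).2 _ _ (hr g⁻¹ u v huv) hv
  · obtain ⟨I, hI, h1, h2⟩ := hF.2.2 _ (hW g⁻¹ p hp)
    refine ⟨g • I, Finset.smul_mem_smul_finset hI, ?_, ?_⟩
    · rwa [← Finset.inv_smul_mem_iff]
    · rwa [← Finset.inv_smul_mem_iff]

variable {N : Type*} [Fintype N]

/-- The functions that are weakly increasing along `r` and strictly increasing along `W`. -/
def increasingFunctions (r : N → N → Prop) (W : Finset (N × N)) : Set (N → ℕ) :=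
  {f | (∀ u v, r u v → f u ≤ f v) ∧ ∀ p ∈ W, f p.1 < f p.2}

/-- The set of elements where `f` takes a value less than `m`. -/
def initialSegment (f : N → ℕ) (m : ℕ) : Finset N := Finset.univ.filter fun v => f v < m

theorem mem_initialSegment {f : N → ℕ} {m : ℕ} {v : N} : v ∈ initialSegment f m ↔ f v < m := by
  simp [initialSegment]

theorem card_initialSegment {f : N → ℕ} {d : ℕ →₀ ℕ} (h : ∑ v, Finsupp.single (f v) 1 = d)
    (m : ℕ) : (initialSegment f m).card = prefixSum d m := by
  rw [prefixSum, ← h]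
  simp only [Finsupp.finsetSum_apply]
  rw [Finset.sum_comm, initialSegment, Finset.card_filter]
  refine Finset.sum_congr rfl fun v _ => ?_
  simp [Finsupp.single_apply]

theorem degree_sum_single (f : N → ℕ) :
    (∑ v, Finsupp.single (f v) 1 : ℕ →₀ ℕ).degree = Fintype.card N := by
  simp [map_sum]

open Classical in
/-- The proper nonempty initial segments of `f`. -/
noncomputable def segmentChain (f : N → ℕ) : Finset (Finset N) :=
  Finset.univ.filter fun I => I.card ∈ Finset.Icc 1 (Fintype.card N - 1) ∧
    ∃ m, I = initialSegment f m

theorem mem_segmentChain {f : N → ℕ} {I : Finset N} :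
    I ∈ segmentChain f ↔ I.card ∈ Finset.Icc 1 (Fintype.card N - 1) ∧
      ∃ m, I = initialSegment f m := by
  simp [segmentChain]

open Classical in
/-- The set of cardinalities of the members of `F`, as a subset of `[n-1]`; the element
`s : Fin (n - 1)` stands for `s + 1 ∈ [n-1]`. -/
noncomputable def chainType (F : Finset (Finset N)) : Finset (Fin (Fintype.card N - 1)) :=
  Finset.univ.filter fun s => ∃ I ∈ F, I.card = s + 1

theorem mem_chainType {F : Finset (Finset N)} {s : Fin (Fintype.card N - 1)} :
    s ∈ chainType F ↔ ∃ I ∈ F, I.card = s + 1 := by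
  simp [chainType]

theorem initialSegment_mono (f : N → ℕ) : Monotone (initialSegment f) := by
  intro m m' h v hv
  rw [mem_initialSegment] at hv ⊢
  omega

theorem segmentChain_mem_faces {r : N → N → Prop} {W : Finset (N × N)} {f : N → ℕ}
    (hf : f ∈ increasingFunctions r W) :
    segmentChain f ∈ faces r W (Finset.Icc 1 (Fintype.card N - 1)) := by
  refine ⟨?_, ?_, ?_⟩
  · intro I hI J hJ _
    obtain ⟨-, m, rfl⟩ := mem_segmentChain.1 hI
    obtain ⟨-, m', rfl⟩ := mem_segmentChain.1 hJ
    exact (le_total m m').imp (fun h => initialSegment_mono f h) fun h => initialSegment_mono f h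
  · intro I hI
    obtain ⟨hc, m, rfl⟩ := mem_segmentChain.1 hI
    refine ⟨hc, fun u v huv hv => ?_⟩
    rw [mem_initialSegment] at hv ⊢
    exact (hf.1 u v huv).trans_lt hv
  · rintro ⟨u, v⟩ hp
    have hlt : f u < f v := hf.2 _ hp
    have hu : u ∈ initialSegment f (f v) := mem_initialSegment.2 hlt
    have hv : v ∉ initialSegment f (f v) := fun h => lt_irrefl _ (mem_initialSegment.1 h)
    refine ⟨initialSegment f (f v), mem_segmentChain.2 ⟨?_, f v, rfl⟩, hu, hv⟩
    have h1 := Finset.card_pos.2 ⟨u, hu⟩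
    have h2 := Finset.card_lt_univ_of_notMem hv
    rw [Finset.mem_Icc]
    omega

theorem chainType_segmentChain {f : N → ℕ} {d : ℕ →₀ ℕ}
    (h : ∑ v, Finsupp.single (f v) 1 = d) :
    chainType (segmentChain f) = prefixSet (Fintype.card N) d := by
  ext s
  have hs := s.2
  rw [mem_chainType, mem_prefixSet]
  constructor
  · rintro ⟨I, hI, hIs⟩
    obtain ⟨-, m, rfl⟩ := mem_segmentChain.1 hI
    exact ⟨m, by rw [← card_initialSegment h, hIs]⟩
  · rintro ⟨m, hm⟩
    rw [← card_initialSegment h] at hm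
    exact ⟨initialSegment f m, mem_segmentChain.2 ⟨Finset.mem_Icc.2 (by omega), m, rfl⟩, hm⟩

theorem eq_of_initialSegment_eq {f f' : N → ℕ}
    (h : ∀ m, initialSegment f m = initialSegment f' m) : f = f' := by
  funext v
  have h1 : ∀ m, f v < m ↔ f' v < m := fun m => by
    rw [← mem_initialSegment, h m, mem_initialSegment]
  have h2 := (h1 (f v + 1)).1 (Nat.lt_succ_self _)
  have h3 := (h1 (f' v + 1)).2 (Nat.lt_succ_self _)
  omega

/-- A function is determined by its initial segments and by the sizes of its fibers. -/
theorem eq_of_segmentChain_eq {f f' : N → ℕ}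
    (h : ∑ v, (Finsupp.single (f v) 1 : ℕ →₀ ℕ) = ∑ v, Finsupp.single (f' v) 1)
    (hF : segmentChain f = segmentChain f') : f = f' := by
  refine eq_of_initialSegment_eq fun m => ?_
  have hc : (initialSegment f m).card = (initialSegment f' m).card := by
    rw [card_initialSegment h, card_initialSegment rfl]
  have hle := Finset.card_le_univ (initialSegment f m)
  by_cases h0 : (initialSegment f m).card = 0
  · rw [Finset.card_eq_zero.1 h0, Finset.card_eq_zero.1 (hc.symm.trans h0)]
  by_cases h1 : (initialSegment f m).card = Fintype.card N
  · rw [(Finset.card_eq_iff_eq_univ _).1 h1, (Finset.card_eq_iff_eq_univ _).1 (hc.symm.trans h1)]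
  have hmem : (initialSegment f m).card ∈ Finset.Icc 1 (Fintype.card N - 1) :=
    Finset.mem_Icc.2 (by omega)
  have hm : initialSegment f m ∈ segmentChain f' := hF ▸ mem_segmentChain.2 ⟨hmem, m, rfl⟩
  have hm' : initialSegment f' m ∈ segmentChain f' := mem_segmentChain.2 ⟨hc ▸ hmem, m, rfl⟩
  -- With no conditions imposed, this only records that the segments of `f'` form a chain, on which
  -- cardinality is injective.
  have hf' : f' ∈ increasingFunctions (fun _ _ => False) ∅ := ⟨fun _ _ h => h.elim, by simp⟩
  exact injOn_card_of_mem_faces (segmentChain_mem_faces hf') hm hm' hc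

theorem card_chainType {F : Finset (Finset N)} {r : N → N → Prop} {W : Finset (N × N)}
    (hF : F ∈ faces r W (Finset.Icc 1 (Fintype.card N - 1))) : (chainType F).card = F.card := by
  have h1 : (chainType F).image (fun s => s.val + 1) = F.image Finset.card := by
    ext k
    simp only [Finset.mem_image, mem_chainType]
    constructor
    · rintro ⟨s, ⟨I, hI, h⟩, rfl⟩
      exact ⟨I, hI, h⟩
    · rintro ⟨I, hI, rfl⟩
      have hc := Finset.mem_Icc.1 (hF.2.1 I hI).1
      exact ⟨⟨I.card - 1, by omega⟩, ⟨I, hI, by simp only; omega⟩, by simp only; omega⟩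
  rw [← Finset.card_image_of_injective (chainType F)
    (f := fun s => s.val + 1) fun a b h => Fin.ext (Nat.succ_injective h), h1,
    Finset.card_image_of_injOn (injOn_card_of_mem_faces hF)]

/-- Identifies the rank-selected complex of the vanishing theorem with the chains whose type is
contained in `S`, over which Möbius inversion sums. -/
theorem mem_faces_image_iff {F : Finset (Finset N)} {r : N → N → Prop} {W : Finset (N × N)}
    {S : Finset (Fin (Fintype.card N - 1))} :
    F ∈ faces r W (S.image fun s => s.val + 1) ↔
      F ∈ faces r W (Finset.Icc 1 (Fintype.card N - 1)) ∧ chainType F ⊆ S := by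
  constructor
  · intro hF
    refine ⟨⟨hF.1, fun I hI => ⟨?_, (hF.2.1 I hI).2⟩, hF.2.2⟩, fun s hs => ?_⟩
    · obtain ⟨s, -, hs⟩ := Finset.mem_image.1 (hF.2.1 I hI).1
      have := s.2
      exact Finset.mem_Icc.2 (by omega)
    · obtain ⟨I, hI, hIs⟩ := mem_chainType.1 hs
      obtain ⟨s', hs', h⟩ := Finset.mem_image.1 (hF.2.1 I hI).1
      rwa [Fin.ext (by omega : (s : ℕ) = s')]
  · rintro ⟨hF, hT⟩
    refine ⟨hF.1, fun I hI => ⟨?_, (hF.2.1 I hI).2⟩, hF.2.2⟩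
    have hc := Finset.mem_Icc.1 (hF.2.1 I hI).1
    have hs : (⟨I.card - 1, by omega⟩ : Fin (Fintype.card N - 1)) ∈ chainType F :=
      mem_chainType.2 ⟨I, hI, by simp only; omega⟩
    exact Finset.mem_image.2 ⟨_, hT hs, by simp only; omega⟩

/-! ### Fixed functions and fixed chains -/

section Action

variable [DecidableEq N] {G : Type*} [Group G] [MulAction G N]

theorem smul_initialSegment {f : N → ℕ} {g : G} (m : ℕ) :
    g • initialSegment f m = initialSegment (fun v => f (g⁻¹ • v)) m := by
  ext v
  rw [← Finset.inv_smul_mem_iff, mem_initialSegment, mem_initialSegment]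

theorem smul_segmentChain (f : N → ℕ) (g : G) :
    g • segmentChain f = segmentChain fun v => f (g⁻¹ • v) := by
  ext I
  rw [← Finset.inv_smul_mem_iff, mem_segmentChain, mem_segmentChain, Finset.card_smul_finset]
  simp only [← smul_initialSegment, inv_smul_eq_iff]

/-- Every chain arises from a function whose fiber sizes are prescribed compatibly. -/
theorem exists_segmentChain_eq {r : N → N → Prop} {W : Finset (N × N)} {F : Finset (Finset N)}
    (hF : F ∈ faces r W (Finset.Icc 1 (Fintype.card N - 1))) {d : ℕ →₀ ℕ}
    (hd : d.degree = Fintype.card N) (hT : chainType F = prefixSet (Fintype.card N) d) :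
    ∃ f ∈ increasingFunctions r W, ∑ v, Finsupp.single (f v) 1 = d ∧ segmentChain f = F := by
  -- Adjoining ∅ and the whole set provides a member `J m` for every partial sum, including 0 and n.
  -- The function sought has the `J m` as its initial segments.
  have hchain : IsChain (· ⊆ ·) (insert ∅ (insert Finset.univ (F : Set (Finset N)))) :=
    (hF.1.insert fun I _ _ => Or.inr (Finset.subset_univ _)).insert
      fun I _ _ => Or.inl (Finset.empty_subset _)
  have hinj := injOn_card_of_isChain hchain
  have hJ : ∀ m, ∃ J ∈ insert ∅ (insert Finset.univ (F : Set (Finset N))),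
      J.card = prefixSum d m := by
    intro m
    have hle := prefixSum_le_degree d m
    by_cases h0 : prefixSum d m = 0
    · exact ⟨∅, Or.inl rfl, by simp [h0]⟩
    by_cases h1 : prefixSum d m = Fintype.card N
    · exact ⟨Finset.univ, Or.inr (Or.inl rfl), by simp [h1]⟩
    have hs : (⟨prefixSum d m - 1, by omega⟩ : Fin (Fintype.card N - 1)) ∈ chainType F := by
      rw [hT, mem_prefixSet]
      exact ⟨m, by simp only; omega⟩
    obtain ⟨I, hI, hIc⟩ := mem_chainType.1 hs
    exact ⟨I, Or.inr (Or.inr hI), by simp only at hIc; omega⟩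
  choose J hJmem hJcard using hJ
  have hmono : ∀ m m', m ≤ m' → J m ⊆ J m' := by
    intro m m' h
    rcases hchain.total (hJmem m) (hJmem m') with h1 | h1
    · exact h1
    · rw [Finset.eq_of_subset_of_card_le h1 (by
        rw [hJcard, hJcard]
        exact prefixSum_mono d h)]
  obtain ⟨M, hM⟩ := exists_prefixSum_eq_degree d
  have hJM : J (M + 1) = Finset.univ := by
    rw [← Finset.card_eq_iff_eq_univ, hJcard]
    have h1 := prefixSum_mono d (Nat.le_succ M)
    have h2 := prefixSum_le_degree d (M + 1)
    rw [Nat.succ_eq_add_one] at h1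
    omega
  have hex : ∀ v, ∃ m, v ∈ J (m + 1) := fun v => ⟨M, hJM ▸ Finset.mem_univ v⟩
  let f : N → ℕ := fun v => Nat.find (hex v)
  have hseg : ∀ m, initialSegment f m = J m := by
    intro m
    ext v
    rw [mem_initialSegment]
    constructor
    · intro h
      exact hmono _ _ h (Nat.find_spec (hex v))
    · intro h
      rcases m with _ | m
      · have : J 0 = ∅ := Finset.card_eq_zero.1 (hJcard 0)
        rw [this] at h
        exact absurd h (Finset.notMem_empty v)
      · exact Nat.lt_succ_of_le (Nat.find_min' (hex v) h)
  have hJF : ∀ I ∈ F, ∃ m, I = J m := by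
    intro I hI
    have hc := Finset.mem_Icc.1 (hF.2.1 I hI).1
    have hs : (⟨I.card - 1, by omega⟩ : Fin (Fintype.card N - 1)) ∈ chainType F :=
      mem_chainType.2 ⟨I, hI, by simp only; omega⟩
    rw [hT, mem_prefixSet] at hs
    obtain ⟨m, hm⟩ := hs
    refine ⟨m, hinj (Or.inr (Or.inr hI)) (hJmem m) ?_⟩
    rw [hJcard, hm]
    simp only
    omega
  have hFJ : ∀ m, (J m).card ∈ Finset.Icc 1 (Fintype.card N - 1) → J m ∈ F := by
    intro m hm
    rw [Finset.mem_Icc] at hm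
    rcases hJmem m with h | h | h
    · rw [h, Finset.card_empty] at hm
      omega
    · rw [h, Finset.card_univ] at hm
      omega
    · exact h
  refine ⟨f, ⟨fun u v huv => ?_, fun p hp => ?_⟩, ?_, ?_⟩
  · have hv : v ∈ J (f v + 1) := Nat.find_spec (hex v)
    have hu : u ∈ J (f v + 1) := by
      rcases hJmem (f v + 1) with h | h | h
      · rw [h] at hv
        exact absurd hv (Finset.notMem_empty v)
      · rw [h]
        exact Finset.mem_univ u
      · exact (hF.2.1 _ h).2 u v huv hv
    exact Nat.find_min' (hex u) hu
  · obtain ⟨I, hI, h1, h2⟩ := hF.2.2 p hp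
    obtain ⟨m, rfl⟩ := hJF I hI
    rw [← hseg, mem_initialSegment] at h1 h2
    omega
  · ext l
    have h1 := card_initialSegment (f := f) rfl (l + 1)
    have h2 := card_initialSegment (f := f) rfl l
    rw [prefixSum_succ, hseg, hJcard, prefixSum_succ] at h1
    rw [hseg, hJcard] at h2
    omega
  · ext I
    rw [mem_segmentChain]
    constructor
    · rintro ⟨hc, m, rfl⟩
      rw [hseg] at hc ⊢
      exact hFJ m hc
    · intro hI
      obtain ⟨m, rfl⟩ := hJF I hI
      exact ⟨(hF.2.1 _ hI).1, m, (hseg m).symm⟩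

/-- The number of chains of type `T` fixed by `g`. -/
noncomputable def fixedChainCount (G : Type*) [Group G] [MulAction G N] (r : N → N → Prop)
    (W : Finset (N × N)) (T : Finset (Fin (Fintype.card N - 1))) (g : G) : ℂ :=
  (Nat.card {F : Finset (Finset N) // F ∈ faces r W (Finset.Icc 1 (Fintype.card N - 1)) ∧
    chainType F = T ∧ g • F = F} : ℂ)

-- Given the content `d`, a function and its chain determine each other. As `g` preserves content,
-- it fixes one exactly when it fixes the other.
open Classical in
theorem genFun_fixedFunctions_apply (r : N → N → Prop) (W : Finset (N × N)) (g : G)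
    (d : ℕ →₀ ℕ) : genFun (fixedFunctions (increasingFunctions r W) g) d =
      if d.degree = Fintype.card N then
        fixedChainCount G r W (prefixSet (Fintype.card N) d) g else 0 := by
  rw [genFun]
  split_ifs with hd
  · rw [fixedChainCount, Nat.cast_inj]
    refine Nat.card_congr (Equiv.ofBijective (fun f => ⟨segmentChain f.1,
      segmentChain_mem_faces f.2.1.1, chainType_segmentChain f.2.2, ?_⟩) ⟨?_, ?_⟩)
    · rw [smul_segmentChain, f.2.1.2]
    · intro f f' h
      exact Subtype.ext (eq_of_segmentChain_eq (f.2.2.trans f'.2.2.symm)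
        (congrArg Subtype.val h))
    · rintro ⟨F, hF, hT, hg⟩
      obtain ⟨f, hf, hfd, rfl⟩ := exists_segmentChain_eq hF hd hT
      refine ⟨⟨f, ⟨hf, ?_⟩, hfd⟩, rfl⟩
      refine eq_of_segmentChain_eq ?_ (by rw [← smul_segmentChain, hg])
      exact Fintype.sum_equiv (MulAction.toPerm g⁻¹) _ _ fun v => rfl
  · have : IsEmpty {f : N → ℕ // f ∈ fixedFunctions (increasingFunctions r W) g ∧
        ∑ v, Finsupp.single (f v) 1 = d} :=
      ⟨fun f => hd (f.2.2 ▸ degree_sum_single f.1)⟩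
    rw [Nat.card_of_isEmpty, Nat.cast_zero]

-- Members of a chain have distinct sizes, so |T| is the number of members: grouping the fixed faces
-- by type or by size gives the same signed sum.
open Classical in
theorem sum_fixedChainCount (r : N → N → Prop) (W : Finset (N × N))
    (S : Finset (Fin (Fintype.card N - 1))) (g : G) :
    ∑ T ∈ S.powerset, (-1) ^ (S.card - T.card) * fixedChainCount G r W T g =
      ∑ i ∈ Finset.range (S.card + 1), (-1) ^ (S.card - i) *
        ((Finset.univ.filter fun F : Finset (Finset N) =>
          (F ∈ faces r W (S.image fun s => s.val + 1) ∧ F.card = i) ∧ g • F = F).card : ℂ) := by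
  set Z : Finset (Finset (Finset N)) := Finset.univ.filter fun F =>
    F ∈ faces r W (S.image fun s => s.val + 1) ∧ g • F = F with hZ
  have hZmem : ∀ F, F ∈ Z ↔ (F ∈ faces r W (Finset.Icc 1 (Fintype.card N - 1)) ∧
      chainType F ⊆ S) ∧ g • F = F := fun F => by
    rw [hZ, Finset.mem_filter, mem_faces_image_iff]
    simp
  have hleft : ∑ T ∈ S.powerset, (-1) ^ (S.card - T.card) * fixedChainCount G r W T g =
      ∑ F ∈ Z, (-1 : ℂ) ^ (S.card - F.card) := by
    rw [← Finset.sum_fiberwise_of_maps_to (s := Z) (t := S.powerset) (g := chainType)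
      fun F hF => Finset.mem_powerset.2 ((hZmem F).1 hF).1.2]
    refine Finset.sum_congr rfl fun T hT => ?_
    have h1 : ∀ F ∈ Z.filter (fun F => chainType F = T),
        (-1 : ℂ) ^ (S.card - F.card) = (-1) ^ (S.card - T.card) := fun F hF => by
      obtain ⟨hFZ, rfl⟩ := Finset.mem_filter.1 hF
      rw [card_chainType ((hZmem F).1 hFZ).1.1]
    rw [Finset.sum_congr rfl h1, Finset.sum_const, nsmul_eq_mul, mul_comm, fixedChainCount,
      Nat.card_eq_fintype_card, Fintype.card_subtype]
    congr 3
    ext F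
    simp only [Finset.mem_filter, Finset.mem_univ, true_and, hZmem]
    constructor
    · rintro ⟨h2, rfl, h3⟩
      exact ⟨⟨⟨h2, Finset.mem_powerset.1 hT⟩, h3⟩, rfl⟩
    · rintro ⟨⟨⟨h2, -⟩, h3⟩, h4⟩
      exact ⟨h2, h4, h3⟩
  rw [hleft, ← Finset.sum_fiberwise_of_maps_to (s := Z) (t := Finset.range (S.card + 1))
    (g := Finset.card)]
  · refine Finset.sum_congr rfl fun i hi => ?_
    have h1 : ∀ F ∈ Z.filter (fun F => F.card = i),
        (-1 : ℂ) ^ (S.card - F.card) = (-1) ^ (S.card - i) := fun F hF => by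
      rw [(Finset.mem_filter.1 hF).2]
    rw [Finset.sum_congr rfl h1, Finset.sum_const, nsmul_eq_mul, mul_comm]
    congr 3
    ext F
    simp only [hZ, Finset.mem_filter, Finset.mem_univ, true_and]
    tauto
  · intro F hF
    have hF' := ((hZmem F).1 hF).1
    rw [Finset.mem_range, ← card_chainType hF'.1]
    exact Nat.lt_succ_of_le (Finset.card_le_card hF'.2)

end Action

end InitialSegments

/-! ### Double posets -/

namespace DoublePoset

variable {N : Type*} (D : DoublePoset N)

/-! ### Automorphisms of double posets and of their mixed graphs -/

section Action

variable {D} {G : Type*} [Group G] [MulAction G N]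

theorem ActsOn.le₁_iff (hG : ActsOn G D) (g : G) {u v : N} :
    D.le₁ (g • u) (g • v) ↔ D.le₁ u v :=
  ⟨fun h => by simpa using (hG g⁻¹ _ _).1 h, (hG g u v).1⟩

theorem ActsOn.le₂_iff (hG : ActsOn G D) (g : G) {u v : N} :
    D.le₂ (g • u) (g • v) ↔ D.le₂ u v :=
  ⟨fun h => by simpa using (hG g⁻¹ _ _).2 h, (hG g u v).2⟩

theorem lt₁_iff {u v : N} : D.lt₁ u v ↔ D.le₁ u v ∧ ¬ D.le₁ v u :=
  D.ord₁.lt_iff_le_not_ge u v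

theorem ActsOn.covBy₁_iff (hG : ActsOn G D) (g : G) {u v : N} :
    D.covBy₁ (g • u) (g • v) ↔ D.covBy₁ u v := by
  have hlt : ∀ {u v}, D.lt₁ (g • u) (g • v) ↔ D.lt₁ u v := fun {u v} => by
    rw [lt₁_iff, lt₁_iff, hG.le₁_iff, hG.le₁_iff]
  refine and_congr hlt ?_
  rw [(MulAction.surjective g).forall]
  simp only [hlt]

theorem ActsOn.isAutomorphism (hG : ActsOn G D) (g : G) :
    D.mixedGraph.IsAutomorphism (MulAction.toPerm g) := by
  refine ⟨fun u v => ?_, fun u v => hG.covBy₁_iff g⟩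
  simp only [mixedGraph, SimpleGraph.fromRel_adj, MulAction.toPerm_apply, hG.covBy₁_iff,
    hG.le₂_iff, ne_eq, (MulAction.injective g).eq_iff]

end Action

variable [Fintype N]

theorem reflTransGen_covBy₁_of_le₁ {x y : N} (h : D.le₁ x y) :
    Relation.ReflTransGen D.covBy₁ x y := by
  classical
  let _ := D.ord₁
  let _ := Fintype.toLocallyFiniteOrder (α := N)
  refine Relation.ReflTransGen.mono (fun a b hab => ?_) _ _ (le_iff_reflTransGen_covBy.1 h)
  exact ⟨hab.1, fun c hc => hab.2 hc.1 hc.2⟩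

/-- Every undirected edge has a parallel directed edge, so ≠ and ≤ combine to a strict inequality.
-/
theorem weakColorings_mixedGraph :
    D.mixedGraph.weakColorings = increasingFunctions D.covBy₁ D.strictPairs := by
  ext f
  constructor
  · rintro ⟨h1, h2⟩
    refine ⟨h2, fun p hp => lt_of_le_of_ne (h2 _ _ (D.mem_strictPairs.1 hp).1) ?_⟩
    exact h1 _ _ (D.undirected_adj_of_mem hp)
  · rintro ⟨h1, h2⟩
    refine ⟨fun u v huv => ?_, h1⟩
    rcases ((SimpleGraph.fromRel_adj _ _ _).1 huv).2 with h | h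
    · exact (h2 (u, v) (D.mem_strictPairs.2 h)).ne
    · exact (h2 (v, u) (D.mem_strictPairs.2 h)).ne'

variable {D}

/-- Strict inequality on an inversion follows from the strict inequality on a shorter inversion
sharing an endpoint and weak monotonicity on the rest, down to descents. -/
theorem InversionReducible.partitions_eq (hD : D.InversionReducible) :
    D.partitions = increasingFunctions D.covBy₁ D.strictPairs := by
  classical
  ext f
  constructor
  · rintro ⟨h1, h2⟩
    refine ⟨fun u v huv => h1 u v (lt₁_iff.1 huv.1).1, fun p hp => ?_⟩
    obtain ⟨hcov, hle⟩ := D.mem_strictPairs.1 hp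
    refine h2 _ _ hcov.1 ((D.ord₂.lt_iff_le_not_ge _ _).2 ⟨hle, fun h => ?_⟩)
    have := D.ord₂.le_antisymm _ _ h hle
    exact (lt₁_iff.1 hcov.1).2 (this ▸ (lt₁_iff.1 hcov.1).1)
  · rintro ⟨h1, h2⟩
    have hmono : ∀ i j, D.le₁ i j → f i ≤ f j := by
      intro i j hij
      induction D.reflTransGen_covBy₁_of_le₁ hij with
      | refl => exact le_rfl
      | tail hab hbc ih => exact (ih (D.le₁_of_reflTransGen_covBy₁ hab)).trans (h1 _ _ hbc)
    refine ⟨hmono, ?_⟩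
    let _ := D.ord₁
    -- The induction is on the size of the open interval between `a` and `b`; passing to `(a, c)` or
    -- `(c, b)` loses at least `c`.
    have hinv : ∀ (k : ℕ) (a b : N), (Finset.univ.filter fun c => D.lt₁ a c ∧ D.lt₁ c b).card = k →
        D.IsInversion a b → f a < f b := by
      intro k
      induction k using Nat.strong_induction_on with
      | _ k ih =>
        intro a b hk hab
        rcases hD a b hab with hdesc | ⟨c, hac, hcb, hc⟩
        · exact h2 (a, b) (D.mem_strictPairs.2
            ⟨hdesc.2, ((D.ord₂.lt_iff_le_not_ge _ _).1 hab.2).1⟩)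
        · have hlt : ∀ a' b', (∀ x, D.lt₁ a' x → D.lt₁ x b' → D.lt₁ a x ∧ D.lt₁ x b) →
              ¬ (D.lt₁ a' c ∧ D.lt₁ c b') →
              (Finset.univ.filter fun x => D.lt₁ a' x ∧ D.lt₁ x b').card < k := by
            intro a' b' hsub hnot
            rw [← hk]
            refine Finset.card_lt_card ((Finset.ssubset_iff_of_subset fun x hx => ?_).2 ⟨c, ?_, ?_⟩)
            · simp only [Finset.mem_filter, Finset.mem_univ, true_and] at hx ⊢
              exact hsub x hx.1 hx.2
            · simpa using ⟨hac, hcb⟩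
            · simpa using hnot
          rcases hc with hc | hc
          · refine (ih _ (hlt a c (fun x h h' => ⟨h, lt_trans (α := N) h' hcb⟩) fun h =>
              lt_irrefl (α := N) c h.2) a c rfl hc).trans_le (hmono _ _ (le_of_lt hcb))
          · exact (hmono _ _ (le_of_lt hac)).trans_lt (ih _ (hlt c b (fun x h h' =>
              ⟨lt_trans (α := N) hac h, h'⟩) fun h => lt_irrefl (α := N) c h.1) c b rfl hc)
    exact fun i j h h' => hinv _ i j rfl ⟨h, h'⟩

open scoped Pointwise in
theorem ActsOn.isEffectiveCharacter_sum_fixedChainCount [DecidableEq N] {G : Type*} [Group G]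
    [MulAction G N] (hG : ActsOn G D) {S : Finset (Fin (Fintype.card N - 1))}
    (hS : S.card ≤ D.mixedGraph.m) :
    IsEffectiveCharacter fun g : G => ∑ T ∈ S.powerset,
      (-1) ^ (S.card - T.card) * fixedChainCount G D.covBy₁ D.strictPairs T g := by
  classical
  simp only [sum_fixedChainCount]
  have hinv : ∀ (g : G), ∀ F ∈ faces D.covBy₁ D.strictPairs (S.image fun s => s.val + 1),
      g • F ∈ faces D.covBy₁ D.strictPairs (S.image fun s => s.val + 1) := by
    intro g F hF
    refine smul_mem_faces (fun g u v => (hG.covBy₁_iff g).2) (fun g p hp => ?_) g hF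
    rw [DoublePoset.mem_strictPairs] at hp ⊢
    rwa [hG.covBy₁_iff, hG.le₂_iff]
  have hcard : ∀ (g : G) (I : Finset N), (g • I).card = I.card :=
    fun g I => Finset.card_smul_finset g I
  refine ColoredComplex.isEffectiveCharacter_of_acyclicAt ordConnected_faces
    (fun F => injOn_card_of_mem_faces) hinv hcard S.card fun i hi => ?_
  -- With c = n the numerical condition of the vanishing theorem becomes i < |S|, and |A| ≤ i < |S|
  -- ≤ m allows the class count.
  refine acyclicAt_faces ?_ _ _ (c := Fintype.card N)
    (fun A hA hAi => D.card_le_numClasses_add_card hA (by omega)) ?_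
  · intro k hk
    obtain ⟨s, -, rfl⟩ := Finset.mem_image.1 hk
    have := s.2
    exact Finset.mem_Icc.2 (by omega)
  · rw [Finset.card_image_of_injective _ fun a b h => Fin.ext (Nat.succ_injective h)]
    omega

end DoublePoset

theorem mainTheorem10 {N : Type*} [Fintype N] (D : DoublePoset N) (hD : D.InversionReducible)
    {G : Type*} [Group G] [Finite G] [MulAction G N] (hG : DoublePoset.ActsOn G D) :
    (∀ g : G, D.mixedGraph.IsAutomorphism (MulAction.toPerm g)) ∧
    (∀ g : G, D.partitionQSym G g = D.mixedGraph.chromaticQSym G g) ∧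
    ∃ c : Finset (Fin (Fintype.card N - 1)) → G → ℂ,
      (∀ c', IsFundamentalExpansion (Fintype.card N) (D.partitionQSym G) c' ↔ c' = c) ∧
      ∀ S, S.card ≤ D.mixedGraph.m → IsEffectiveCharacter (c S) := by
  classical
  refine ⟨hG.isAutomorphism, fun g => ?_, fun S g => ∑ T ∈ S.powerset,
    (-1) ^ (S.card - T.card) * fixedChainCount G D.covBy₁ D.strictPairs T g, fun c' => ?_,
    fun S hS => ?_⟩
  · rw [DoublePoset.partitionQSym, MixedGraph.chromaticQSym, hD.partitions_eq,
      D.weakColorings_mixedGraph]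
  · rw [isFundamentalExpansion_iff (a := fixedChainCount G D.covBy₁ D.strictPairs)]
    · simp only [funext_iff]
    · intro g d
      rw [DoublePoset.partitionQSym, hD.partitions_eq, genFun_fixedFunctions_apply]
  · exact hG.isEffectiveCharacter_sum_fixedChainCount hS
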